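/- Let $k\ge 2$ be real, let $D^0=\{z\in\mathbb C:|\operatorname{Re}z|<\pi/2\}$, and let $f(z)=z+\overline{g(z)}$ with $g(z)=-k/\sin z$. Let $D^+=\{z\in D^0\setminus\{0\}:1-|g'(z)|^2>0\}$ be the part of the strip where the Jacobian determinant $1-|g'|^2$ of $f$ is positive (the pole $0$ is excluded). Then $D^+$ has at most four connected components, and for every $w\in\mathbb C\setminus f(\partial D^+)$ the index $I_w(f(\partial D^+))$ is well defined and satisfies $$|I_w(f(\partial D^+))|\le 3.$$ Here the boundary is taken in the extended plane and $I_w(f(\partial D^+))=m$ means the following: for all sufficiently large $R$, the open set $D^+_R=D^+\cap\{z:|\operatorname{Im}z|<R\}$ has finitely many connected components, each of them bounded by a Jordan curve, and the sum, over these components $V$, of the winding numbers about $w$ of the closed curves $f\circ\gamma_V$ equals $m$, where $\gamma_V$ is any parametrization of the Jordan curve $\partial V$ as a simple closed curve with $V$ on its left. -/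

import Mathlib

noncomputable section

/-- The open strip `|Re z| < π / 2`. -/
def lensStrip : Set ℂ := {z : ℂ | |z.re| < Real.pi / 2}

/-- The meromorphic function `g(z) = -k / sin z`. -/
def lensG (k : ℝ) (z : ℂ) : ℂ := -(k : ℂ) / Complex.sin z

/-- The harmonic map `f(z) = z + conj (g(z))`. -/
def lensMap (k : ℝ) (z : ℂ) : ℂ := z + (starRingEnd ℂ) (lensG k z)

/-- The Jacobian determinant `1 - |g'(z)|²` of `f` (meaningful away from the poles of `f`). -/
def lensJacobian (k : ℝ) (z : ℂ) : ℝ := 1 - ‖deriv (lensG k) z‖ ^ 2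

/-- The orientation-preserving part `D⁺` of the strip: the points with positive Jacobian.
The origin is the only pole of `f` in the strip (there `|g'| = ∞`, so it does not belong to `D⁺`). -/
def lensDplus (k : ℝ) : Set ℂ := {z : ℂ | z ∈ lensStrip ∧ z ≠ 0 ∧ 0 < lensJacobian k z}

/-- The bounded pieces `D⁺ ∩ {|Im z| < R}`, which exhaust `D⁺` as `R → ∞`. -/
def lensDplusTrunc (k R : ℝ) : Set ℂ := lensDplus k ∩ {z : ℂ | |z.im| < R}

/-- The set of connected components of a set. -/
def componentsOf (U : Set ℂ) : Set (Set ℂ) := {V | ∃ z ∈ U, V = connectedComponentIn U z}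

/-- The closed curve `c : [0, 1] → ℂ` avoids `w` and has winding number `m` about `w`: there is a
continuous branch `L` of `log (c - w)` along `c`, and it increases by `2 π i m`. -/
def HasWindingNumber (c : ℝ → ℂ) (w : ℂ) (m : ℤ) : Prop :=
  ∃ L : ℝ → ℂ, ContinuousOn L (Set.Icc 0 1) ∧
    (∀ t ∈ Set.Icc (0 : ℝ) 1, c t - w = Complex.exp (L t)) ∧
    L 1 - L 0 = 2 * (Real.pi : ℂ) * Complex.I * (m : ℂ)

/-- `γ : [0, 1] → ℂ` is a Jordan curve which parametrizes the boundary of `V`, with `V` on the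
left, that is, with winding number `1` about the points of `V`. -/
structure IsPositiveJordanBoundary (γ : ℝ → ℂ) (V : Set ℂ) : Prop where
  continuousOn : ContinuousOn γ (Set.Icc 0 1)
  closed : γ 0 = γ 1
  injOn : Set.InjOn γ (Set.Ico 0 1)
  image_eq : γ '' Set.Icc 0 1 = frontier V
  positive : ∀ z ∈ V, HasWindingNumber γ z 1

/-- `I_w(F(∂U)) = m`, for an open set `U` with finitely many components, each of them bounded by a
Jordan curve: the sum, over the components `V` of `U`, of the winding numbers about `w` of the
images under `F` of the positively oriented boundary curves of `V`. -/
def HasBoundaryIndex (F : ℂ → ℂ) (U : Set ℂ) (w : ℂ) (m : ℤ) : Prop :=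
  ∃ (S : Finset (Set ℂ)) (γ : Set ℂ → ℝ → ℂ) (n : Set ℂ → ℤ),
    (S : Set (Set ℂ)) = componentsOf U ∧
    (∀ V ∈ S, IsPositiveJordanBoundary (γ V) V) ∧
    (∀ V ∈ S, HasWindingNumber (fun t => F (γ V t)) w (n V)) ∧
    m = ∑ V ∈ S, n V

/-- `I_w(f(∂D⁺)) = m`, with the boundary of the unbounded set `D⁺` taken in the extended plane:
for all large `R`, the index of `f(∂(D⁺ ∩ {|Im z| < R}))` about `w` exists, does not depend on the
choice of the parametrizations, and equals `m`. -/
def HasDplusIndex (k : ℝ) (w : ℂ) (m : ℤ) : Prop :=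
  ∀ᶠ R : ℝ in Filter.atTop,
    HasBoundaryIndex (lensMap k) (lensDplusTrunc k R) w m ∧
    ∀ m' : ℤ, HasBoundaryIndex (lensMap k) (lensDplusTrunc k R) w m' → m' = m

end

noncomputable section

open Set Complex

/-! Both `D⁺` and `f` respect `z ↦ -z`: the Jacobian is even and `f` is odd. With `u = cos² x` and
`S = sinh² y` one has `|sin z|² = S + 1 - u` and `|cos z|² = S + u`, so the Jacobian has the sign of
`(S + 1 - u)² - k² (S + u)`. For `k ≥ 2` this is quadratic in `u` and in `S` with real roots, and
`D⁺` splits into a lens at the right edge of the strip, a cap going up to infinity, and the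
negatives of both (`mem_lensRegion_iff`, `topGraph_lt_im_iff`, `lensDplus_cases`).

Each boundary curve is cut into two arcs along which `Im f` is injective. On the vertical edges `Im
f = Im z`. On the critical curve `|sin z|² = k |cos z|`, so `k` cancels and `Im f = y - t s / √(t² +
s²)` with `t = cos x`, `s = sinh y`; its monotonicity along the curves is the analytic core
(`strictMonoOn_lensMap_sideGraph`, `strictMonoOn_lensMap_topGraph`). Such an arc meets the
horizontal line through `w` at most once, so it avoids a ray from `w` and changes `arg (f - w)` by
less than `2π`. Two arcs give less than `4π`, hence winding number `-1`, `0` or `1` for each of the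
four components.

This bounds the index by `4`. The last unit is gained because `Im f > 0` on the curve bounding the
cap (`lensMap_im_pos`): the cap contributes nothing when `Im w ≤ 0`, and by symmetry its negative
contributes nothing when `Im w ≥ 0`. The cut at height `R` is harmless since `Im f ≥ R - 1` there.
-/

/-! ### Logarithms along paths and winding numbers -/

/-- A continuous closed or open path that avoids `w` has a continuous logarithm. -/
theorem exists_continuousOn_log_path {c : ℝ → ℂ} {w : ℂ} (hc : ContinuousOn c (Icc 0 1))
    (hw : ∀ t ∈ Icc (0 : ℝ) 1, c t ≠ w) :
    ∃ L : ℝ → ℂ, ContinuousOn L (Icc 0 1) ∧ ∀ t ∈ Icc (0 : ℝ) 1, c t - w = exp (L t) := by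
  have h01 : (0 : ℝ) ≤ 1 := zero_le_one
  have hg : Continuous fun t : ℝ => c (projIcc 0 1 h01 t) - w :=
    (hc.domRestrict.comp continuous_projIcc).sub continuous_const
  obtain ⟨F, ⟨-, hF⟩, -⟩ := isCoveringMapOn_exp.existsUnique_continuousMap_lifts
    (⟨_, hg⟩ : C(ℝ, ℂ)) (a₀ := 0)
    (exp_log (sub_ne_zero.2 (hw _ (projIcc 0 1 h01 0).2)))
    (fun t => sub_ne_zero.2 (hw _ (projIcc 0 1 h01 t).2))
  refine ⟨F, F.continuous.continuousOn, fun t ht => ?_⟩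
  have := congrFun hF t
  simp only [Function.comp_apply, ContinuousMap.coe_mk, projIcc_of_mem h01 ht] at this
  exact this.symm

/-- Two continuous logarithms of the same path have the same increment. -/
theorem sub_eq_sub_of_exp_eq {p q : ℝ} (hpq : p ≤ q) {L M : ℝ → ℂ}
    (hL : ContinuousOn L (Icc p q)) (hM : ContinuousOn M (Icc p q))
    (h : ∀ t ∈ Icc p q, exp (L t) = exp (M t)) : L q - L p = M q - M p := by
  have hp : p ∈ Icc p q := left_mem_Icc.2 hpq
  have hd : ∀ t ∈ Icc p q, exp (M t + (L p - M p)) = exp (L t) := fun t ht => by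
    rw [exp_add, exp_sub, ← h t ht, ← h p hp, div_self (exp_ne_zero _), mul_one]
  have key := isCoveringMap_exp.eqOn_of_comp_eqOn isPreconnected_Icc
    (g₁ := fun t => M t + (L p - M p)) (g₂ := L) (hM.add continuousOn_const) hL
    (fun t ht => Subtype.ext (hd t ht)) hp (by ring)
  have := key (right_mem_Icc.2 hpq)
  simp only at this
  rw [← this]; ring

theorem HasWindingNumber.unique {c : ℝ → ℂ} {w : ℂ} {m n : ℤ} (hm : HasWindingNumber c w m)
    (hn : HasWindingNumber c w n) : m = n := by
  obtain ⟨L, hL, hcL, hLm⟩ := hm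
  obtain ⟨M, hM, hcM, hMn⟩ := hn
  have := sub_eq_sub_of_exp_eq zero_le_one hL hM fun t ht => by rw [← hcL t ht, ← hcM t ht]
  rw [hLm, hMn] at this
  have h2 : 2 * (Real.pi : ℂ) * I ≠ 0 := two_pi_I_ne_zero
  exact_mod_cast mul_left_cancel₀ h2 this

theorem HasWindingNumber.neg {c : ℝ → ℂ} {w : ℂ} {m : ℤ} (h : HasWindingNumber c w m) :
    HasWindingNumber (fun t => -c t) (-w) m := by
  obtain ⟨L, hL, hcL, hLm⟩ := h
  refine ⟨fun t => L t + Real.pi * I, hL.add continuousOn_const, fun t ht => ?_, ?_⟩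
  · rw [exp_add, ← hcL t ht, exp_pi_mul_I]; ring
  · rw [← hLm]; ring

/-- On an arc that avoids a ray from `w` the increment of the logarithm is computed by the principal
branch. -/
theorem sub_eq_log_sub_log {p q : ℝ} (hpq : p ≤ q) {c L : ℝ → ℂ} {w e : ℂ}
    (hc : ContinuousOn c (Icc p q)) (hL : ContinuousOn L (Icc p q))
    (hcL : ∀ t ∈ Icc p q, c t - w = exp (L t))
    (hs : ∀ t ∈ Icc p q, e * (c t - w) ∈ slitPlane) :
    L q - L p = log (e * (c q - w)) - log (e * (c p - w)) := by
  have he : e ≠ 0 := fun h => by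
    have := hs p (left_mem_Icc.2 hpq)
    simp [h] at this
  have h := sub_eq_sub_of_exp_eq (M := fun t => log (e * (c t - w)) - log e) hpq hL
    (((continuousOn_const.mul (hc.sub continuousOn_const)).clog hs).sub continuousOn_const)
    (fun t ht => by
      rw [exp_sub, exp_log (slitPlane_ne_zero (hs t ht)), exp_log he, ← hcL t ht]
      field_simp)
  rw [h]; ring

theorem log_neg_of_im_pos {z : ℂ} (hz : 0 < z.im) : log (-z) = log z - Real.pi * I := by
  simp only [log, norm_neg, arg_neg_eq_arg_sub_pi_of_im_pos hz]
  push_cast; ring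

theorem log_neg_of_im_neg {z : ℂ} (hz : z.im < 0) : log (-z) = log z + Real.pi * I := by
  simp only [log, norm_neg, arg_neg_eq_arg_add_pi_of_im_neg hz]
  push_cast; ring

/-- A closed path that crosses from one side of `w` to the other, first in front of `w` and then
back behind `w`, has winding number one. -/
theorem hasWindingNumber_one {c : ℝ → ℂ} {w e : ℂ} (hc : ContinuousOn c (Icc 0 1))
    (h01 : c 0 = c 1) (h₁ : ∀ t ∈ Icc (0 : ℝ) (1 / 2), e * (c t - w) ∈ slitPlane)
    (h₂ : ∀ t ∈ Icc (1 / 2 : ℝ) 1, -(e * (c t - w)) ∈ slitPlane)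
    (hn : (e * (c 0 - w)).im < 0) (hp : 0 < (e * (c (1 / 2) - w)).im) :
    HasWindingNumber c w 1 := by
  have hne : ∀ t ∈ Icc (0 : ℝ) 1, c t ≠ w := fun t ht h => by
    rcases le_total t (1 / 2) with h' | h'
    · simpa [h] using h₁ t ⟨ht.1, h'⟩
    · simpa [h] using h₂ t ⟨h', ht.2⟩
  obtain ⟨L, hL, hcL⟩ := exists_continuousOn_log_path hc hne
  have s₁ : Icc (0 : ℝ) (1 / 2) ⊆ Icc 0 1 := Icc_subset_Icc_right (by norm_num)
  have s₂ : Icc (1 / 2 : ℝ) 1 ⊆ Icc 0 1 := Icc_subset_Icc_left (by norm_num)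
  have k₁ := sub_eq_log_sub_log (by norm_num) (hc.mono s₁) (hL.mono s₁)
    (fun t ht => hcL t (s₁ ht)) h₁
  have k₂ := sub_eq_log_sub_log (e := -e) (by norm_num) (hc.mono s₂) (hL.mono s₂)
    (fun t ht => hcL t (s₂ ht)) (fun t ht => by simpa using h₂ t ht)
  refine ⟨L, hL, hcL, ?_⟩
  -- The branches `log (e ·)` and `log (-e ·)` differ by `-πi` at one junction and by `πi` at the
  -- other; together they give `2πi`.
  rw [neg_mul, neg_mul, log_neg_of_im_pos hp, ← h01, log_neg_of_im_neg hn] at k₂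
  push_cast
  linear_combination k₁ + k₂

/-- The bound `4π` is what two arcs provide, each avoiding a ray and so turning by less than `2π`.
-/
theorem exists_int_of_exp_eq_one {δ : ℂ} (h : exp δ = 1) (hb : |δ.im| < 4 * Real.pi) :
    ∃ m : ℤ, |m| ≤ 1 ∧ δ = 2 * (Real.pi : ℂ) * I * m := by
  obtain ⟨m, hm⟩ := exp_eq_one_iff.1 h
  refine ⟨m, ?_, by rw [hm]; ring⟩
  have him : δ.im = m * (2 * Real.pi) := by rw [hm]; simp
  rw [him, abs_mul, abs_of_pos Real.two_pi_pos] at hb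
  have : |(m : ℝ)| < 2 := by
    by_contra! h'
    nlinarith [Real.pi_pos]
  have h2 : |m| < 2 := by exact_mod_cast this
  omega

theorem abs_im_log_sub_log_lt {z z' : ℂ} (hz : z ∈ slitPlane) (hz' : z' ∈ slitPlane) :
    |(log z - log z').im| < 2 * Real.pi := by
  have a₁ := neg_pi_lt_arg z
  have a₂ := (arg_le_pi z).lt_of_ne (mem_slitPlane_iff_arg.1 hz).1
  have b₁ := neg_pi_lt_arg z'
  have b₂ := (arg_le_pi z').lt_of_ne (mem_slitPlane_iff_arg.1 hz').1
  simp only [sub_im, log_im, abs_lt]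
  constructor <;> linarith

/-- A closed path consisting of two arcs, each of which avoids a ray from `w`, has winding number
`-1`, `0` or `1` about `w`. -/
theorem exists_hasWindingNumber_of_two_arcs {c : ℝ → ℂ} {w e₁ e₂ : ℂ}
    (hc : ContinuousOn c (Icc 0 1)) (h01 : c 0 = c 1)
    (h₁ : ∀ t ∈ Icc (0 : ℝ) (1 / 2), e₁ * (c t - w) ∈ slitPlane)
    (h₂ : ∀ t ∈ Icc (1 / 2 : ℝ) 1, e₂ * (c t - w) ∈ slitPlane) :
    ∃ m : ℤ, |m| ≤ 1 ∧ HasWindingNumber c w m := by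
  have hne : ∀ t ∈ Icc (0 : ℝ) 1, c t ≠ w := fun t ht h => by
    rcases le_total t (1 / 2) with h' | h'
    · simpa [h] using h₁ t ⟨ht.1, h'⟩
    · simpa [h] using h₂ t ⟨h', ht.2⟩
  obtain ⟨L, hL, hcL⟩ := exists_continuousOn_log_path hc hne
  have s₁ : Icc (0 : ℝ) (1 / 2) ⊆ Icc 0 1 := Icc_subset_Icc_right (by norm_num)
  have s₂ : Icc (1 / 2 : ℝ) 1 ⊆ Icc 0 1 := Icc_subset_Icc_left (by norm_num)
  have k₁ := sub_eq_log_sub_log (by norm_num) (hc.mono s₁) (hL.mono s₁)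
    (fun t ht => hcL t (s₁ ht)) h₁
  have k₂ := sub_eq_log_sub_log (by norm_num) (hc.mono s₂) (hL.mono s₂)
    (fun t ht => hcL t (s₂ ht)) h₂
  have b₁ := abs_im_log_sub_log_lt (h₁ (1 / 2) (by norm_num)) (h₁ 0 (by norm_num))
  have b₂ := abs_im_log_sub_log_lt (h₂ 1 (by norm_num)) (h₂ (1 / 2) (by norm_num))
  rw [← k₁] at b₁
  rw [← k₂] at b₂
  obtain ⟨m, hm, hδ⟩ := exists_int_of_exp_eq_one (δ := L 1 - L 0)
    (by rw [exp_sub, ← hcL 1 (by norm_num), ← hcL 0 (by norm_num), h01,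
          div_self (sub_ne_zero.2 (hne 1 (by norm_num)))])
    (by
      simp only [sub_im] at *
      rw [abs_lt] at *
      constructor <;> linarith)
  exact ⟨m, hm, L, hL, hcL, hδ⟩

/-- The winding number about `w` of a closed path with a point high above `w` depends only on its
lowest point, if both arcs between these points avoid the left or the right ray from `w`. -/
theorem exists_hasWindingNumber_of_base {w ζ e₁ e₂ : ℂ} (hζ : ζ ≠ w)
    (he₁ : e₁ = 1 ∨ e₁ = -1) (he₂ : e₂ = 1 ∨ e₂ = -1)
    (h₁ : e₁ * (ζ - w) ∈ slitPlane) (h₂ : e₂ * (ζ - w) ∈ slitPlane) :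
    ∃ m : ℤ, |m| ≤ 1 ∧ (e₁ = e₂ → m = 0) ∧ ∀ c : ℝ → ℂ, ContinuousOn c (Icc 0 1) → c 0 = c 1 →
      (∀ t ∈ Icc (0 : ℝ) (1 / 4), e₁ * (c t - w) ∈ slitPlane) →
      (∀ t ∈ Icc (1 / 4 : ℝ) (3 / 4), e₂ * (c t - w) ∈ slitPlane) →
      (∀ t ∈ Icc (3 / 4 : ℝ) 1, e₁ * (c t - w) ∈ slitPlane) →
      c (1 / 4) = ζ → w.im < (c (3 / 4)).im → HasWindingNumber c w m := by
  -- `κ` is the constant by which the two branches differ in the upper half-plane; where exactly `c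
  -- (3 / 4)` lies above `w` is therefore irrelevant.
  obtain ⟨κ, hκ, hκe, hκb, hκz⟩ : ∃ κ : ℂ,
      (∀ z : ℂ, 0 < z.im → log (e₂ * z) - log (e₁ * z) = κ) ∧ exp κ = e₂ / e₁ ∧
      |κ.im| ≤ Real.pi ∧ (e₁ = e₂ → κ = 0) := by
    have hn : (1 : ℂ) ≠ -1 := by norm_num
    have hπ := Real.pi_pos
    rcases he₁ with rfl | rfl <;> rcases he₂ with rfl | rfl
    · exact ⟨0, by simp, by simp, by simp [hπ.le], by simp⟩
    · refine ⟨-(Real.pi * I), fun z hz => ?_, ?_, ?_, ?_⟩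
      · rw [neg_one_mul, one_mul, log_neg_of_im_pos hz]; ring
      · rw [exp_neg, exp_pi_mul_I]; norm_num
      · simp [abs_of_pos hπ]
      · intro h; exact absurd h hn
    · refine ⟨Real.pi * I, fun z hz => ?_, ?_, ?_, ?_⟩
      · rw [neg_one_mul, one_mul, log_neg_of_im_pos hz]; ring
      · rw [exp_pi_mul_I]; norm_num
      · simp [abs_of_pos hπ]
      · intro h; exact absurd h.symm hn
    · exact ⟨0, by simp, by simp, by simp [hπ.le], by simp⟩
  have e₁0 : e₁ ≠ 0 := by rcases he₁ with rfl | rfl <;> norm_num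
  have e₂0 : e₂ ≠ 0 := by rcases he₂ with rfl | rfl <;> norm_num
  have hζ' := sub_ne_zero.2 hζ
  have b := abs_im_log_sub_log_lt h₁ h₂
  -- The total increment of the logarithm: a change of branch at `ζ`, and the change `κ` back at `c
  -- (3 / 4)`. Its imaginary part is below `2π + π`.
  obtain ⟨m, hm, hδ⟩ := exists_int_of_exp_eq_one
    (δ := log (e₁ * (ζ - w)) - log (e₂ * (ζ - w)) + κ)
    (by
      rw [exp_add, exp_sub, exp_log (slitPlane_ne_zero h₁), exp_log (slitPlane_ne_zero h₂), hκe]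
      field_simp)
    (by
      rw [add_im]
      refine (abs_add_le _ _).trans_lt ?_
      linarith [Real.pi_pos])
  refine ⟨m, hm, fun h => ?_, fun c hc h01 g₁ g₂ g₃ hcζ hci => ?_⟩
  · rw [hκz h, h, sub_self, zero_add] at hδ
    have := (mul_eq_zero.1 hδ.symm).resolve_left two_pi_I_ne_zero
    exact_mod_cast this
  have hne : ∀ t ∈ Icc (0 : ℝ) 1, c t ≠ w := fun t ht h => by
    rcases le_total t (1 / 4) with h' | h'
    · simpa [h] using g₁ t ⟨ht.1, h'⟩
    rcases le_total t (3 / 4) with h'' | h''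
    · simpa [h] using g₂ t ⟨h', h''⟩
    · simpa [h] using g₃ t ⟨h'', ht.2⟩
  obtain ⟨L, hL, hcL⟩ := exists_continuousOn_log_path hc hne
  have s₁ : Icc (0 : ℝ) (1 / 4) ⊆ Icc 0 1 := Icc_subset_Icc_right (by norm_num)
  have s₂ : Icc (1 / 4 : ℝ) (3 / 4) ⊆ Icc 0 1 := Icc_subset_Icc (by norm_num) (by norm_num)
  have s₃ : Icc (3 / 4 : ℝ) 1 ⊆ Icc 0 1 := Icc_subset_Icc_left (by norm_num)
  have k₁ := sub_eq_log_sub_log (by norm_num) (hc.mono s₁) (hL.mono s₁)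
    (fun t ht => hcL t (s₁ ht)) g₁
  have k₂ := sub_eq_log_sub_log (by norm_num) (hc.mono s₂) (hL.mono s₂)
    (fun t ht => hcL t (s₂ ht)) g₂
  have k₃ := sub_eq_log_sub_log (by norm_num) (hc.mono s₃) (hL.mono s₃)
    (fun t ht => hcL t (s₃ ht)) g₃
  have k := hκ (c (3 / 4) - w) (by simpa using hci)
  rw [h01, hcζ] at k₁
  rw [hcζ] at k₂
  exact ⟨L, hL, hcL, by rw [← hδ]; linear_combination k₁ + k₂ + k₃ + k⟩

/-! ### Independence of the parametrization -/

theorem AddCircle.liftIco_one_coe {B : Type*} (f : ℝ → B) (x : ℝ) :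
    AddCircle.liftIco 1 0 f (x : AddCircle (1 : ℝ)) = f (Int.fract x) := by
  have h : (x : AddCircle (1 : ℝ)) = (Int.fract x : ℝ) := by
    rw [← sub_eq_zero, ← AddCircle.coe_sub, AddCircle.coe_eq_zero_iff]
    exact ⟨⌊x⌋, by simp [← Int.self_sub_floor]⟩
  rw [h]
  exact AddCircle.liftIco_zero_coe_apply ⟨Int.fract_nonneg x, Int.fract_lt_one x⟩

/-- A path on a simple closed curve lifts to the line that parametrizes the curve. -/
theorem exists_lift_of_simple_closed {γ γ' : ℝ → ℂ} (hγ : ContinuousOn γ (Icc 0 1))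
    (h01 : γ 0 = γ 1) (hinj : InjOn γ (Ico 0 1)) (hγ' : ContinuousOn γ' (Icc 0 1))
    (h01' : γ' 0 = γ' 1) (him : γ' '' Icc 0 1 ⊆ γ '' Icc 0 1) :
    ∃ (h : ℝ → ℝ) (d : ℤ), ContinuousOn h (Icc 0 1) ∧ h 1 - h 0 = d ∧
      ∀ t ∈ Icc (0 : ℝ) 1, γ' t = γ (Int.fract (h t)) := by
  set Γ : AddCircle (1 : ℝ) → ℂ := AddCircle.liftIco 1 0 γ with hΓ
  have hΓc : Continuous Γ := AddCircle.liftIco_zero_continuous h01 hγ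
  have hΓi : Function.Injective Γ := by
    intro a b hab
    obtain ⟨x, rfl⟩ := QuotientAddGroup.mk_surjective a
    obtain ⟨y, rfl⟩ := QuotientAddGroup.mk_surjective b
    rw [hΓ] at hab
    erw [AddCircle.liftIco_one_coe, AddCircle.liftIco_one_coe] at hab
    have := hinj ⟨Int.fract_nonneg x, Int.fract_lt_one x⟩
      ⟨Int.fract_nonneg y, Int.fract_lt_one y⟩ hab
    change ((x : ℝ) : AddCircle (1 : ℝ)) = (y : ℝ)
    rw [← sub_eq_zero, ← AddCircle.coe_sub, AddCircle.coe_eq_zero_iff]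
    obtain ⟨z, hz⟩ := Int.fract_eq_fract.1 this
    exact ⟨z, by simp [hz]⟩
  -- The circle is compact, so the injective `Γ` is an embedding and `a = Γ⁻¹ ∘ γ'` is continuous.
  -- The lift of `a` to the line is read off from a logarithm along the unit circle.
  have hemb : Topology.IsEmbedding Γ := (hΓc.isClosedEmbedding hΓi).isEmbedding
  have hrange : ∀ t ∈ Icc (0 : ℝ) 1, ∃ a, Γ a = γ' t := by
    intro t ht
    obtain ⟨s, hs, hst⟩ := him (mem_image_of_mem _ ht)
    rcases hs.2.eq_or_lt with rfl | hs1
    · exact ⟨((0 : ℝ) : AddCircle (1 : ℝ)), by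
        rw [hΓ, AddCircle.liftIco_one_coe, Int.fract_zero, h01, hst]⟩
    · exact ⟨(s : AddCircle (1 : ℝ)), by
        rw [hΓ, AddCircle.liftIco_one_coe, Int.fract_eq_self.2 ⟨hs.1, hs1⟩, hst]⟩
  choose! a ha using hrange
  have hac : ContinuousOn a (Icc 0 1) :=
    hemb.continuousOn_iff.2 (hγ'.congr fun t ht => ha t ht)
  obtain ⟨ℓ, hℓ, hℓa⟩ := exists_continuousOn_log_path
    (c := fun t => ((AddCircle.toCircle (a t) : Circle) : ℂ)) (w := 0)
    ((continuous_subtype_val : Continuous fun z : Circle => (z : ℂ)).comp_continuousOn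
      (AddCircle.continuous_toCircle.comp_continuousOn hac))
    (fun t _ => Circle.coe_ne_zero _)
  have hlift : ∀ t ∈ Icc (0 : ℝ) 1,
      (((ℓ t).im / (2 * Real.pi) : ℝ) : AddCircle (1 : ℝ)) = a t := by
    intro t ht
    apply AddCircle.injective_toCircle (T := (1 : ℝ)) one_ne_zero
    apply Circle.ext
    have h := hℓa t ht
    rw [sub_zero] at h
    have hre : (ℓ t).re = 0 := by
      have := congrArg norm h
      rw [Circle.norm_coe, norm_exp] at this
      exact (Real.exp_eq_one_iff _).1 this.symm
    rw [h, AddCircle.toCircle_apply_mk, Circle.coe_exp]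
    congr 1
    rw [show 2 * Real.pi / 1 * ((ℓ t).im / (2 * Real.pi)) = (ℓ t).im by
      field_simp]
    apply Complex.ext <;> simp [hre]
  have ha01 : a 0 = a 1 := hΓi (by
    rw [ha 0 (by norm_num), ha 1 (by norm_num), h01'])
  have hd : (((ℓ 1).im / (2 * Real.pi) - (ℓ 0).im / (2 * Real.pi) : ℝ) : AddCircle (1 : ℝ)) = 0 := by
    rw [AddCircle.coe_sub, hlift 1 (by norm_num), hlift 0 (by norm_num), ha01, sub_self]
  obtain ⟨d, hd⟩ := (AddCircle.coe_eq_zero_iff _).1 hd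
  refine ⟨fun t => (ℓ t).im / (2 * Real.pi), d, ?_, ?_, fun t ht => ?_⟩
  · exact (continuous_im.comp_continuousOn hℓ).div_const _
  · simpa using hd.symm
  · rw [← ha t ht, ← hlift t ht, hΓ, AddCircle.liftIco_one_coe]

/-- Subtracting the drift `2πi n t` makes the logarithm `L` periodic, so it descends to the circle
as `K`; adding the drift back along `h` gives a logarithm of the reparametrized path. -/
theorem HasWindingNumber.comp_lift {c : ℝ → ℂ} {w : ℂ} {n d : ℤ} {h : ℝ → ℝ}
    (hc : HasWindingNumber c w n) (hh : ContinuousOn h (Icc 0 1)) (hd : h 1 - h 0 = d) :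
    HasWindingNumber (fun t => c (Int.fract (h t))) w (n * d) := by
  obtain ⟨L, hL, hcL, hLn⟩ := hc
  set K : AddCircle (1 : ℝ) → ℂ :=
    AddCircle.liftIco 1 0 (fun t : ℝ => L t - 2 * (Real.pi : ℂ) * I * n * t) with hK
  have hKc : Continuous K := AddCircle.liftIco_zero_continuous
    (by push_cast; linear_combination -hLn) (hL.sub (by fun_prop))
  have hKh : ∀ x : ℝ, K x = L (Int.fract x) - 2 * (Real.pi : ℂ) * I * n * (Int.fract x : ℝ) :=
    fun x => AddCircle.liftIco_one_coe _ x
  refine ⟨fun t => K (h t : ℝ) + 2 * (Real.pi : ℂ) * I * n * (h t : ℝ), ?_, fun t ht => ?_, ?_⟩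
  · exact (hKc.comp_continuousOn ((AddCircle.continuous_mk' (1 : ℝ)).comp_continuousOn hh)).add
      (continuousOn_const.mul (continuous_ofReal.comp_continuousOn hh))
  · beta_reduce
    rw [hKh, hcL _ ⟨Int.fract_nonneg _, (Int.fract_lt_one _).le⟩]
    have : exp (2 * (Real.pi : ℂ) * I * n * (⌊h t⌋ : ℤ)) = 1 :=
      exp_eq_one_iff.2 ⟨n * ⌊h t⌋, by push_cast; ring⟩
    rw [← mul_one (exp (L (Int.fract (h t)))), ← this, ← exp_add]
    congr 1
    have h2 : ((h t : ℝ) : ℂ) = (⌊h t⌋ : ℤ) + (Int.fract (h t) : ℝ) := by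
      exact_mod_cast (Int.floor_add_fract (h t)).symm
    rw [h2]; ring
  · have hfr : Int.fract (h 1) = Int.fract (h 0) := Int.fract_eq_fract.2 ⟨d, hd⟩
    have hd' : ((h 1 : ℝ) : ℂ) - (h 0 : ℝ) = d := by exact_mod_cast hd
    simp only [hKh, hfr]
    push_cast
    linear_combination (2 * (Real.pi : ℂ) * I * n) * hd'

/-- The winding number of the image of a positively oriented Jordan curve does not depend on the
parametrization. -/
theorem IsPositiveJordanBoundary.windingNumber_unique {γ γ' : ℝ → ℂ} {V : Set ℂ} {F : ℂ → ℂ}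
    {w : ℂ} {n n' : ℤ} (hV : V.Nonempty) (hγ : IsPositiveJordanBoundary γ V)
    (hγ' : IsPositiveJordanBoundary γ' V) (hn : HasWindingNumber (fun t => F (γ t)) w n)
    (hn' : HasWindingNumber (fun t => F (γ' t)) w n') : n' = n := by
  obtain ⟨h, d, hh, hd, hγh⟩ := exists_lift_of_simple_closed hγ.continuousOn hγ.closed hγ.injOn
    hγ'.continuousOn hγ'.closed (by rw [hγ.image_eq, hγ'.image_eq])
  have congr_winding : ∀ {c c' : ℝ → ℂ} {u : ℂ} {m : ℤ}, (∀ t ∈ Icc (0 : ℝ) 1, c' t = c t) →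
      HasWindingNumber c u m → HasWindingNumber c' u m := fun hcc ⟨L, h₁, h₂, h₃⟩ =>
    ⟨L, h₁, fun t ht => by rw [hcc t ht, h₂ t ht], h₃⟩
  obtain ⟨z, hz⟩ := hV
  -- Both curves wind once around a point of `V`, which forces the degree `d` to be `1`.
  have h1 := (congr_winding hγh ((hγ.positive z hz).comp_lift hh hd)).unique (hγ'.positive z hz)
  have h2 := (congr_winding (fun t ht => congrArg F (hγh t ht)) (hn.comp_lift hh hd)).unique hn'
  rw [← h2, show d = 1 by simpa using h1, mul_one]

theorem HasBoundaryIndex.unique {F : ℂ → ℂ} {U : Set ℂ} {w : ℂ} {m m' : ℤ}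
    (h : HasBoundaryIndex F U w m) (h' : HasBoundaryIndex F U w m') : m' = m := by
  obtain ⟨S, γ, n, hS, hγ, hn, rfl⟩ := h
  obtain ⟨S', γ', n', hS', hγ', hn', rfl⟩ := h'
  obtain rfl : S' = S := Finset.coe_injective (hS'.trans hS.symm)
  refine Finset.sum_congr rfl fun V hV => ?_
  obtain ⟨z, hz, rfl⟩ : V ∈ componentsOf U := by rw [← hS]; exact hV
  exact IsPositiveJordanBoundary.windingNumber_unique ⟨z, mem_connectedComponentIn hz⟩
    (hγ _ hV) (hγ' _ hV) (hn _ hV) (hn' _ hV)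

theorem IsPositiveJordanBoundary.neg {γ : ℝ → ℂ} {V : Set ℂ} (h : IsPositiveJordanBoundary γ V) :
    IsPositiveJordanBoundary (fun t => -γ t) (-V) where
  continuousOn := h.continuousOn.neg
  closed := by rw [h.closed]
  injOn s hs t ht hst := h.injOn hs ht (neg_injective hst)
  image_eq := by
    have : frontier (-V) = -frontier V :=
      ((Homeomorph.neg ℂ).preimage_frontier V).symm
    rw [this, ← h.image_eq, ← image_neg_eq_neg, image_image]
  positive z hz := by simpa using (h.positive (-z) hz).neg

/-! ### Components and boundary index of a disjoint union -/

/-- The components of a disjoint union of connected open sets. -/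
theorem componentsOf_iUnion {ι : Type*} {V : ι → Set ℂ} (ho : ∀ i, IsOpen (V i))
    (hp : ∀ i, IsPreconnected (V i)) (hne : ∀ i, (V i).Nonempty)
    (hd : Pairwise (Function.onFun Disjoint V)) : componentsOf (⋃ i, V i) = range V := by
  have key : ∀ i, ∀ z ∈ V i, connectedComponentIn (⋃ i, V i) z = V i := by
    intro i z hz
    have hzU : z ∈ ⋃ i, V i := mem_iUnion.2 ⟨i, hz⟩
    refine Subset.antisymm ?_
      ((hp i).subset_connectedComponentIn hz (subset_iUnion V i))
    refine isPreconnected_connectedComponentIn.subset_left_of_subset_union (ho i)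
      (isOpen_iUnion fun j : {j // j ≠ i} => ho j)
      (disjoint_iUnion_right.2 fun j => hd j.2.symm) ?_ ⟨z, mem_connectedComponentIn hzU, hz⟩
    intro y hy
    obtain ⟨j, hj⟩ := mem_iUnion.1 (connectedComponentIn_subset _ _ hy)
    by_cases hji : j = i
    · exact Or.inl (hji ▸ hj)
    · exact Or.inr (mem_iUnion.2 ⟨⟨j, hji⟩, hj⟩)
  ext W
  constructor
  · rintro ⟨z, hz, rfl⟩
    obtain ⟨i, hi⟩ := mem_iUnion.1 hz
    exact ⟨i, (key i z hi).symm⟩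
  · rintro ⟨i, rfl⟩
    obtain ⟨z, hz⟩ := hne i
    exact ⟨z, mem_iUnion.2 ⟨i, hz⟩, (key i z hz).symm⟩

theorem hasBoundaryIndex_iUnion {ι : Type*} [Fintype ι] {V : ι → Set ℂ} {F : ℂ → ℂ} {w : ℂ}
    {n : ι → ℤ} (ho : ∀ i, IsOpen (V i)) (hp : ∀ i, IsPreconnected (V i))
    (hne : ∀ i, (V i).Nonempty) (hd : Pairwise (Function.onFun Disjoint V))
    (h : ∀ i, ∃ γ, IsPositiveJordanBoundary γ (V i) ∧
      HasWindingNumber (fun t => F (γ t)) w (n i)) :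
    HasBoundaryIndex F (⋃ i, V i) w (∑ i, n i) := by
  classical
  choose γ hγ hn using h
  have hinj : Function.Injective V := fun i j hij => by
    by_contra hne'
    have := hd hne'
    rw [Function.onFun, hij, disjoint_self] at this
    exact (hne j).ne_empty this
  refine ⟨Finset.univ.image V, Function.extend V γ 0, Function.extend V n 0, ?_, ?_, ?_, ?_⟩
  · rw [componentsOf_iUnion ho hp hne hd]; simp
  · simp only [Finset.mem_image, Finset.mem_univ, true_and, forall_exists_index,
      forall_apply_eq_imp_iff, hinj.extend_apply]
    exact hγ
  · simp only [Finset.mem_image, Finset.mem_univ, true_and, forall_exists_index,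
      forall_apply_eq_imp_iff, hinj.extend_apply]
    exact hn
  · rw [Finset.sum_image fun i _ j _ hij => hinj hij]
    simp [hinj.extend_apply]

/-! ### Regions between two graphs and their boundary curves -/

section Band

variable {φ ψ : ℝ → ℝ} {a b : ℝ}

/-- The region between the graphs of `φ` and `ψ` over `(a, b)`. -/
def bandRegion (φ ψ : ℝ → ℝ) (a b : ℝ) : Set (ℝ × ℝ) :=
  {q | q.1 ∈ Ioo a b ∧ φ q.1 < q.2 ∧ q.2 < ψ q.1}

theorem isOpen_bandRegion (hφ : Continuous φ) (hψ : Continuous ψ) :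
    IsOpen (bandRegion φ ψ a b) :=
  (isOpen_Ioo.preimage continuous_fst).inter
    ((isOpen_lt (hφ.comp continuous_fst) continuous_snd).inter
      (isOpen_lt continuous_snd (hψ.comp continuous_fst)))

/-- Interpolating linearly on vertical fibres reduces connectedness and closure to those of a
rectangle. -/
theorem bandRegion_eq_image (h : ∀ x ∈ Ioo a b, φ x < ψ x) :
    bandRegion φ ψ a b =
      (fun q : ℝ × ℝ => (q.1, φ q.1 + q.2 * (ψ q.1 - φ q.1))) '' (Ioo a b ×ˢ Ioo 0 1) := by
  ext ⟨x, y⟩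
  constructor
  · rintro ⟨hx, h₁, h₂⟩
    have hd : 0 < ψ x - φ x := sub_pos.2 (h x hx)
    refine ⟨(x, (y - φ x) / (ψ x - φ x)), ⟨hx, div_pos (sub_pos.2 h₁) hd, ?_⟩, ?_⟩
    · rw [div_lt_one hd]; exact sub_lt_sub_right h₂ _
    · simp only [Prod.mk.injEq, true_and]
      rw [div_mul_cancel₀ _ hd.ne']; ring
  · rintro ⟨⟨x', l⟩, ⟨hx, hl⟩, he⟩
    simp only [Prod.mk.injEq] at he
    obtain ⟨rfl, rfl⟩ := he
    have hd : 0 < ψ x' - φ x' := sub_pos.2 (h x' hx)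
    refine ⟨hx, ?_, ?_⟩
    · have := mul_pos hl.1 hd
      simp only at this ⊢; linarith
    · have := mul_lt_mul_of_pos_right hl.2 hd
      simp only at this ⊢; linarith

theorem isPreconnected_bandRegion (hφ : Continuous φ) (hψ : Continuous ψ)
    (h : ∀ x ∈ Ioo a b, φ x < ψ x) : IsPreconnected (bandRegion φ ψ a b) := by
  rw [bandRegion_eq_image h]
  exact (isPreconnected_Ioo.prod isPreconnected_Ioo).image _ (by fun_prop)

theorem closure_bandRegion (hab : a < b) (hφ : Continuous φ) (hψ : Continuous ψ)
    (h : ∀ x ∈ Ioo a b, φ x < ψ x) :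
    closure (bandRegion φ ψ a b) = {q | q.1 ∈ Icc a b ∧ φ q.1 ≤ q.2 ∧ q.2 ≤ ψ q.1} := by
  apply Subset.antisymm
  · refine closure_minimal (fun q hq => ⟨Ioo_subset_Icc_self hq.1, hq.2.1.le, hq.2.2.le⟩) ?_
    exact (isClosed_Icc.preimage continuous_fst).inter
      ((isClosed_le (hφ.comp continuous_fst) continuous_snd).inter
        (isClosed_le continuous_snd (hψ.comp continuous_fst)))
  · rintro ⟨x, y⟩ ⟨hx, h₁, h₂⟩
    simp only at hx h₁ h₂
    rw [bandRegion_eq_image h]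
    have hmem : ∀ l ∈ Icc (0 : ℝ) 1, (x, φ x + l * (ψ x - φ x)) ∈ closure
        ((fun q : ℝ × ℝ => (q.1, φ q.1 + q.2 * (ψ q.1 - φ q.1))) '' (Ioo a b ×ˢ Ioo 0 1)) := by
      intro l hl
      refine image_closure_subset_closure_image (by fun_prop) ⟨(x, l), ?_, rfl⟩
      rw [closure_prod_eq, closure_Ioo hab.ne, closure_Ioo zero_ne_one]
      exact ⟨hx, hl⟩
    -- Over an endpoint the graphs may meet, as they do for the lens; the fibre is then a point.
    rcases (h₁.trans h₂).eq_or_lt with he | hlt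
    · have := hmem 0 (by norm_num)
      rwa [zero_mul, add_zero, le_antisymm h₁ (he ▸ h₂)] at this
    · have hd : 0 < ψ x - φ x := sub_pos.2 hlt
      have := hmem ((y - φ x) / (ψ x - φ x))
        ⟨div_nonneg (sub_nonneg.2 h₁) hd.le, (div_le_one hd).2 (by linarith)⟩
      rwa [div_mul_cancel₀ _ hd.ne', add_sub_cancel] at this

theorem mem_frontier_bandRegion (hab : a < b) (hφ : Continuous φ) (hψ : Continuous ψ)
    (h : ∀ x ∈ Ioo a b, φ x < ψ x) {q : ℝ × ℝ} :
    q ∈ frontier (bandRegion φ ψ a b) ↔ (q.1 ∈ Icc a b ∧ φ q.1 ≤ q.2 ∧ q.2 ≤ ψ q.1) ∧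
      (q.1 = a ∨ q.1 = b ∨ q.2 = φ q.1 ∨ q.2 = ψ q.1) := by
  rw [(isOpen_bandRegion hφ hψ).frontier_eq, closure_bandRegion hab hφ hψ h, mem_sdiff]
  refine and_congr_right fun ⟨h₁, h₂, h₃⟩ => ⟨fun hq => ?_, fun hq hq' => ?_⟩
  · by_contra! hc
    exact hq ⟨⟨lt_of_le_of_ne h₁.1 hc.1.symm, lt_of_le_of_ne h₁.2 hc.2.1⟩,
      lt_of_le_of_ne h₂ hc.2.2.1.symm, lt_of_le_of_ne h₃ hc.2.2.2⟩
  · obtain ⟨⟨k₁, k₂⟩, k₃, k₄⟩ := hq'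
    rcases hq with hq | hq | hq | hq <;> linarith

end Band

/-- The coordinates `(Re z, Im z)`. -/
def reImHomeomorph : ℂ ≃ₜ ℝ × ℝ := equivRealProdCLM.toHomeomorph

/-- The coordinates `(Im z, Re z)`. -/
def imReHomeomorph : ℂ ≃ₜ ℝ × ℝ := reImHomeomorph.trans (Homeomorph.prodComm ℝ ℝ)

@[simp] theorem reImHomeomorph_apply (z : ℂ) : reImHomeomorph z = (z.re, z.im) := rfl

@[simp] theorem imReHomeomorph_apply (z : ℂ) : imReHomeomorph z = (z.im, z.re) := rfl

section Lens

variable {X : ℝ → ℝ} {b p : ℝ}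

/-- The region between the graph `x = X y` and the line `x = p`, for `|y| < b`. -/
def lensRegion (X : ℝ → ℝ) (b p : ℝ) : Set ℂ := {z | |z.im| < b ∧ X z.im < z.re ∧ z.re < p}

theorem lensRegion_eq : lensRegion X b p =
    imReHomeomorph ⁻¹' bandRegion X (fun _ => p) (-b) b := by
  ext z; simp [lensRegion, bandRegion, abs_lt]

theorem isOpen_lensRegion (hX : Continuous X) : IsOpen (lensRegion X b p) := by
  rw [lensRegion_eq]
  exact (isOpen_bandRegion hX continuous_const).preimage imReHomeomorph.continuous

theorem isPreconnected_lensRegion (hX : Continuous X) (h : ∀ y ∈ Ioo (-b) b, X y < p) :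
    IsPreconnected (lensRegion X b p) := by
  rw [lensRegion_eq, ← imReHomeomorph.image_symm]
  exact (isPreconnected_bandRegion hX continuous_const h).image _
    imReHomeomorph.symm.continuous.continuousOn

/-- The boundary curve of `lensRegion X b p`: the segment upwards, the graph downwards. -/
def lensCurve (X : ℝ → ℝ) (b p t : ℝ) : ℂ :=
  if t ≤ 1 / 2 then ⟨p, b * (4 * t - 1)⟩ else ⟨X (b * (3 - 4 * t)), b * (3 - 4 * t)⟩

theorem lensCurve_of_le {t : ℝ} (ht : t ≤ 1 / 2) : lensCurve X b p t = ⟨p, b * (4 * t - 1)⟩ :=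
  if_pos ht

theorem lensCurve_of_ge (hb : X b = p) {t : ℝ} (ht : 1 / 2 ≤ t) :
    lensCurve X b p t = ⟨X (b * (3 - 4 * t)), b * (3 - 4 * t)⟩ := by
  rcases ht.eq_or_lt with rfl | h
  · rw [lensCurve_of_le le_rfl]; norm_num [hb]
  · exact if_neg h.not_ge

theorem continuous_lensCurve (hX : Continuous X) (hb : X b = p) :
    Continuous (lensCurve X b p) := by
  have hmk : ∀ {u v : ℝ → ℝ}, Continuous u → Continuous v →
      Continuous fun t => (⟨u t, v t⟩ : ℂ) := fun hu hv =>
    reImHomeomorph.symm.continuous.comp (hu.prodMk hv)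
  refine Continuous.if_le (hmk (by fun_prop) (by fun_prop)) (hmk (by fun_prop) (by fun_prop))
    continuous_id continuous_const fun t ht => ?_
  obtain rfl : t = 1 / 2 := ht
  norm_num [hb]

theorem isPositiveJordanBoundary_lensCurve (hb0 : 0 < b) (hX : Continuous X)
    (h : ∀ y ∈ Ioo (-b) b, X y < p) (hb : X b = p) (hb' : X (-b) = p) :
    IsPositiveJordanBoundary (lensCurve X b p) (lensRegion X b p) := by
  have hc := continuous_lensCurve hX hb
  have h01 : lensCurve X b p 0 = lensCurve X b p 1 := by
    rw [lensCurve_of_le (by norm_num), lensCurve_of_ge hb (by norm_num)]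
    norm_num [hb']
  have hmixed : ∀ s t : ℝ, 0 ≤ s → s ≤ 1 / 2 → 1 / 2 < t → t < 1 →
      lensCurve X b p s ≠ lensCurve X b p t := by
    intro s t hs hs' ht ht' he
    rw [lensCurve_of_le hs', lensCurve_of_ge hb ht.le] at he
    have := congrArg re he
    simp only at this
    exact (h (b * (3 - 4 * t)) ⟨by nlinarith, by nlinarith⟩).ne this.symm
  refine ⟨hc.continuousOn, h01, ?_, ?_, ?_⟩
  · intro s hs t ht hst
    rcases le_or_gt s (1 / 2) with hs' | hs' <;> rcases le_or_gt t (1 / 2) with ht' | ht'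
    · rw [lensCurve_of_le hs', lensCurve_of_le ht'] at hst
      have := mul_left_cancel₀ hb0.ne' (congrArg im hst)
      linarith
    · exact absurd hst (hmixed s t hs.1 hs' ht' ht.2)
    · exact absurd hst.symm (hmixed t s ht.1 ht' hs' hs.2)
    · rw [lensCurve_of_ge hb hs'.le, lensCurve_of_ge hb ht'.le] at hst
      have := mul_left_cancel₀ hb0.ne' (congrArg im hst)
      linarith
  · ext z
    rw [lensRegion_eq, ← imReHomeomorph.preimage_frontier, mem_preimage,
      mem_frontier_bandRegion (by linarith) hX continuous_const h]
    simp only [imReHomeomorph_apply, mem_image]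
    constructor
    · rintro ⟨t, ht, rfl⟩
      rcases le_total t (1 / 2) with ht' | ht'
      · rw [lensCurve_of_le ht']
        have hy : b * (4 * t - 1) ∈ Icc (-b) b := ⟨by nlinarith [ht.1], by nlinarith⟩
        refine ⟨⟨hy, ?_, le_rfl⟩, Or.inr (Or.inr (Or.inr rfl))⟩
        rcases eq_or_ne (b * (4 * t - 1)) b with e | e
        · simp [e, hb]
        rcases eq_or_ne (b * (4 * t - 1)) (-b) with e' | e'
        · simp [e', hb']
        exact (h _ ⟨lt_of_le_of_ne hy.1 e'.symm, lt_of_le_of_ne hy.2 e⟩).le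
      · rw [lensCurve_of_ge hb ht']
        have hy : b * (3 - 4 * t) ∈ Icc (-b) b := ⟨by nlinarith [ht.2], by nlinarith⟩
        refine ⟨⟨hy, le_rfl, ?_⟩, Or.inr (Or.inr (Or.inl rfl))⟩
        rcases eq_or_ne (b * (3 - 4 * t)) b with e | e
        · simp [e, hb]
        rcases eq_or_ne (b * (3 - 4 * t)) (-b) with e' | e'
        · simp [e', hb']
        exact (h _ ⟨lt_of_le_of_ne hy.1 e'.symm, lt_of_le_of_ne hy.2 e⟩).le
    · rintro ⟨⟨⟨h₁, h₂⟩, h₃, h₄⟩, h₅⟩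
      have hq : -1 ≤ z.im / b ∧ z.im / b ≤ 1 :=
        ⟨by rw [le_div_iff₀ hb0]; linarith, by rw [div_le_iff₀ hb0]; linarith⟩
      have hseg : z.re = p → ∃ t ∈ Icc (0 : ℝ) 1, lensCurve X b p t = z := fun hz => by
        refine ⟨(z.im / b + 1) / 4, ⟨by linarith, by linarith⟩, ?_⟩
        rw [lensCurve_of_le (by linarith)]
        apply Complex.ext
        · exact hz.symm
        · simp only; field_simp; ring
      rcases h₅ with h₅ | h₅ | h₅ | h₅
      · rw [h₅, hb'] at h₃; exact hseg (le_antisymm h₄ h₃)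
      · rw [h₅, hb] at h₃; exact hseg (le_antisymm h₄ h₃)
      · refine ⟨(3 - z.im / b) / 4, ⟨by linarith, by linarith⟩, ?_⟩
        rw [lensCurve_of_ge hb (by linarith)]
        have : b * (3 - 4 * ((3 - z.im / b) / 4)) = z.im := by field_simp; ring
        rw [this, ← h₅]
      · exact hseg h₅
  · rintro z ⟨hz₁, hz₂, hz₃⟩
    rw [abs_lt] at hz₁
    -- The segment avoids the ray from `z` to the left, the graph the ray to the right.
    refine hasWindingNumber_one (e := 1) hc.continuousOn h01 ?_ ?_ ?_ ?_
    · intro t ht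
      rw [lensCurve_of_le ht.2, one_mul, mem_slitPlane_iff]
      exact Or.inl (by simpa using hz₃)
    · intro t ht
      rw [lensCurve_of_ge hb ht.1, one_mul, mem_slitPlane_iff]
      rcases eq_or_ne (b * (3 - 4 * t)) z.im with e | e
      · exact Or.inl (by simpa [e] using hz₂)
      · exact Or.inr (by simpa [sub_eq_zero] using e.symm)
    · rw [lensCurve_of_le (by norm_num)]; simp; linarith
    · rw [lensCurve_of_le le_rfl]; norm_num; linarith

end Lens

section Cap

variable {Y : ℝ → ℝ} {p R : ℝ}

/-- The region between the graph `y = Y x` and the line `y = R`, for `|x| < p`. -/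
def capRegion (Y : ℝ → ℝ) (p R : ℝ) : Set ℂ := {z | |z.re| < p ∧ Y z.re < z.im ∧ z.im < R}

theorem capRegion_eq : capRegion Y p R =
    reImHomeomorph ⁻¹' bandRegion Y (fun _ => R) (-p) p := by
  ext z; simp [capRegion, bandRegion, abs_lt]

theorem isOpen_capRegion (hY : Continuous Y) : IsOpen (capRegion Y p R) := by
  rw [capRegion_eq]
  exact (isOpen_bandRegion hY continuous_const).preimage reImHomeomorph.continuous

theorem isPreconnected_capRegion (hY : Continuous Y) (h : ∀ x ∈ Ioo (-p) p, Y x < R) :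
    IsPreconnected (capRegion Y p R) := by
  rw [capRegion_eq, ← reImHomeomorph.image_symm]
  exact (isPreconnected_bandRegion hY continuous_const h).image _
    reImHomeomorph.symm.continuous.continuousOn

/-- The boundary of the region above the graph of `Y` over `[-p, p]`: a ray downwards, the graph,
and a ray upwards. -/
def capPath (Y : ℝ → ℝ) (p s : ℝ) : ℂ :=
  ⟨max (-p) (min s p), Y (max (-p) (min s p)) + max (|s| - p) 0⟩

theorem capPath_of_abs_le {s : ℝ} (hs : |s| ≤ p) : capPath Y p s = ⟨s, Y s⟩ := by
  rw [abs_le] at hs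
  rw [capPath, min_eq_left hs.2, max_eq_right hs.1, max_eq_right, add_zero]
  rw [sub_nonpos, abs_le]; exact hs

theorem capPath_of_ge (hp : 0 ≤ p) {s : ℝ} (hs : p ≤ s) :
    capPath Y p s = ⟨p, Y p + (s - p)⟩ := by
  rw [capPath, min_eq_right hs, max_eq_right (by linarith), abs_of_nonneg (hp.trans hs),
    max_eq_left (by linarith)]

theorem capPath_of_le_neg (hp : 0 ≤ p) {s : ℝ} (hs : s ≤ -p) :
    capPath Y p s = ⟨-p, Y (-p) + (-s - p)⟩ := by
  rw [capPath, min_eq_left (by linarith), max_eq_left (by linarith), abs_of_nonpos (by linarith),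
    max_eq_left (by linarith)]

theorem continuous_complex_mk {T : Type*} [TopologicalSpace T] {u v : T → ℝ} (hu : Continuous u)
    (hv : Continuous v) : Continuous fun t => (⟨u t, v t⟩ : ℂ) :=
  reImHomeomorph.symm.continuous.comp (hu.prodMk hv)

theorem continuous_capPath (hY : Continuous Y) : Continuous (capPath Y p) :=
  continuous_complex_mk (by fun_prop) (by fun_prop)

/-- The boundary curve of `capRegion Y p R`. -/
def capCurve (Y : ℝ → ℝ) (p R t : ℝ) : ℂ :=
  if t ≤ 1 / 2 then capPath Y p ((4 * t - 1) * (p + R - Y p)) else ⟨p * (3 - 4 * t), R⟩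

theorem capCurve_of_le {t : ℝ} (ht : t ≤ 1 / 2) :
    capCurve Y p R t = capPath Y p ((4 * t - 1) * (p + R - Y p)) := if_pos ht

theorem capCurve_of_ge (hp : 0 < p) (hR : Y p < R) {t : ℝ} (ht : 1 / 2 ≤ t) :
    capCurve Y p R t = ⟨p * (3 - 4 * t), R⟩ := by
  rcases ht.eq_or_lt with rfl | h
  · rw [capCurve_of_le le_rfl, capPath_of_ge hp.le (by linarith)]
    apply Complex.ext
    · norm_num
    · norm_num; ring
  · exact if_neg h.not_ge

theorem continuous_capCurve (hp : 0 < p) (hR : Y p < R) (hY : Continuous Y) :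
    Continuous (capCurve Y p R) := by
  refine Continuous.if_le ((continuous_capPath hY).comp (by fun_prop))
    (continuous_complex_mk (by fun_prop) (by fun_prop)) continuous_id continuous_const
    fun t ht => ?_
  obtain rfl : t = 1 / 2 := ht
  rw [← capCurve_of_le le_rfl, capCurve_of_ge hp hR le_rfl]

theorem capCurve_closed (hp : 0 < p) (hR : Y p < R) (hYp : Y (-p) = Y p) :
    capCurve Y p R 0 = capCurve Y p R 1 := by
  rw [capCurve_of_le (by norm_num), capCurve_of_ge hp hR (by norm_num),
    capPath_of_le_neg hp.le (by linarith), hYp]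
  apply Complex.ext
  · norm_num
  · norm_num; ring

theorem capPath_injective (hp : 0 < p) (hYp : Y (-p) = Y p) :
    Function.Injective (capPath Y p) := by
  have hcases : ∀ s, (p ≤ s ∧ capPath Y p s = ⟨p, Y p + (s - p)⟩) ∨
      (s ≤ -p ∧ capPath Y p s = ⟨-p, Y p + (-s - p)⟩) ∨ capPath Y p s = ⟨s, Y s⟩ := by
    intro s
    rcases le_total p s with h | h
    · exact Or.inl ⟨h, capPath_of_ge hp.le h⟩
    rcases le_total s (-p) with h' | h'
    · exact Or.inr (Or.inl ⟨h', by rw [capPath_of_le_neg hp.le h', hYp]⟩)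
    · exact Or.inr (Or.inr (capPath_of_abs_le (abs_le.2 ⟨h', h⟩)))
  intro s t hst
  rcases hcases s with ⟨hs, hs'⟩ | ⟨hs, hs'⟩ | hs' <;>
  rcases hcases t with ⟨ht, ht'⟩ | ⟨ht, ht'⟩ | ht' <;>
  · rw [hs', ht'] at hst
    have h₁ := congrArg re hst
    have h₂ := congrArg im hst
    simp only at h₁ h₂
    first
    | linarith
    | (rw [← h₁] at h₂; linarith)
    | (rw [h₁] at h₂; linarith)

theorem capPath_re_mem (hp : 0 < p) (s : ℝ) : (capPath Y p s).re ∈ Icc (-p) p :=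
  ⟨le_max_left _ _, max_le (by linarith) (min_le_right _ _)⟩

/-- As `R` exceeds `Y` on the closed interval, the path `capPath` reaches height `R` only at its two
ends, where the top edge closes it up. -/
theorem isPositiveJordanBoundary_capCurve (hp : 0 < p) (hY : Continuous Y)
    (hR : ∀ x ∈ Icc (-p) p, Y x < R) (hYp : Y (-p) = Y p) :
    IsPositiveJordanBoundary (capCurve Y p R) (capRegion Y p R) := by
  have hRp : Y p < R := hR p ⟨by linarith, le_rfl⟩
  have hR' : ∀ x ∈ Ioo (-p) p, Y x < R := fun x hx => hR x (Ioo_subset_Icc_self hx)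
  have hc := continuous_capCurve hp hRp hY
  have h01 := capCurve_closed hp hRp hYp
  have hT : 0 < p + R - Y p := by linarith
  have hedge : ∀ s, |s| ≤ p + R - Y p → (capPath Y p s).im ≤ R ∧
      ((capPath Y p s).im = R → |s| = p + R - Y p) := by
    intro s hs
    rcases le_total |s| p with h | h
    · rw [capPath_of_abs_le h]
      have := hR s (abs_le.1 h)
      exact ⟨this.le, fun h' => absurd h' this.ne⟩
    · rcases le_total 0 s with h0 | h0
      · rw [abs_of_nonneg h0] at *
        rw [capPath_of_ge hp.le h]
        simp only
        constructor <;> intros <;> linarith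
      · rw [abs_of_nonpos h0] at *
        rw [capPath_of_le_neg hp.le (by linarith), hYp]
        simp only
        constructor <;> intros <;> linarith
  have habs : ∀ t ∈ Icc (0 : ℝ) (1 / 2), |(4 * t - 1) * (p + R - Y p)| ≤ p + R - Y p := by
    intro t ht
    rw [abs_mul, abs_of_pos hT]
    have : |4 * t - 1| ≤ 1 := abs_le.2 ⟨by linarith [ht.1], by linarith [ht.2]⟩
    nlinarith
  have hmixed : ∀ s t : ℝ, 0 ≤ s → s ≤ 1 / 2 → 1 / 2 < t → t < 1 →
      capCurve Y p R s ≠ capCurve Y p R t := by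
    intro s t hs hs' ht ht' he
    rw [capCurve_of_le hs', capCurve_of_ge hp hRp ht.le] at he
    have h₁ := (hedge _ (habs s ⟨hs, hs'⟩)).2 (congrArg im he)
    have h₂ := congrArg re he
    simp only at h₂
    rcases (abs_eq hT.le).1 h₁ with h | h
    · rw [h, capPath_of_ge hp.le (by linarith)] at h₂
      simp only at h₂; nlinarith
    · rw [h, capPath_of_le_neg hp.le (by linarith)] at h₂
      simp only at h₂; nlinarith
  refine ⟨hc.continuousOn, h01, ?_, ?_, ?_⟩
  · intro s hs t ht hst
    rcases le_or_gt s (1 / 2) with hs' | hs' <;> rcases le_or_gt t (1 / 2) with ht' | ht'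
    · rw [capCurve_of_le hs', capCurve_of_le ht'] at hst
      have := mul_right_cancel₀ hT.ne' (capPath_injective hp hYp hst)
      linarith
    · exact absurd hst (hmixed s t hs.1 hs' ht' ht.2)
    · exact absurd hst.symm (hmixed t s ht.1 ht' hs' hs.2)
    · rw [capCurve_of_ge hp hRp hs'.le, capCurve_of_ge hp hRp ht'.le] at hst
      have := mul_left_cancel₀ hp.ne' (congrArg re hst)
      linarith
  · ext z
    rw [capRegion_eq, ← reImHomeomorph.preimage_frontier, mem_preimage,
      mem_frontier_bandRegion (by linarith) hY continuous_const hR']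
    simp only [reImHomeomorph_apply, mem_image]
    constructor
    · rintro ⟨t, ht, rfl⟩
      rcases le_total t (1 / 2) with ht' | ht'
      · rw [capCurve_of_le ht']
        have ha := habs t ⟨ht.1, ht'⟩
        set s := (4 * t - 1) * (p + R - Y p)
        refine ⟨⟨capPath_re_mem hp s, ?_, (hedge s ha).1⟩, ?_⟩
        · simp [capPath]
        · rcases le_total |s| p with h | h
          · rw [capPath_of_abs_le h]; simp
          · rcases le_total 0 s with h0 | h0
            · rw [capPath_of_ge hp.le (by rwa [abs_of_nonneg h0] at h)]; simp
            · rw [capPath_of_le_neg hp.le (by rw [abs_of_nonpos h0] at h; linarith)]; simp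
      · rw [capCurve_of_ge hp hRp ht']
        have hx : p * (3 - 4 * t) ∈ Icc (-p) p := ⟨by nlinarith [ht.2], by nlinarith⟩
        exact ⟨⟨hx, (hR _ hx).le, le_rfl⟩, Or.inr (Or.inr (Or.inr rfl))⟩
    · rintro ⟨⟨⟨h₁, h₂⟩, h₃, h₄⟩, h₅⟩
      have hpath : ∀ s, |s| ≤ p + R - Y p → capPath Y p s = z →
          ∃ t ∈ Icc (0 : ℝ) 1, capCurve Y p R t = z := by
        intro s hs hz
        rw [abs_le] at hs
        have hq : -1 ≤ s / (p + R - Y p) ∧ s / (p + R - Y p) ≤ 1 :=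
          ⟨by rw [le_div_iff₀ hT]; linarith, by rw [div_le_iff₀ hT]; linarith⟩
        refine ⟨(s / (p + R - Y p) + 1) / 4, ⟨by linarith, by linarith⟩, ?_⟩
        rw [capCurve_of_le (by linarith), ← hz]
        congr 1
        field_simp; ring
      rcases h₅ with h₅ | h₅ | h₅ | h₅
      · rw [h₅, hYp] at h₃
        refine hpath (-(z.im - Y p + p)) ?_ ?_
        · rw [abs_neg, abs_of_nonneg (by linarith)]; linarith
        · rw [capPath_of_le_neg hp.le (by linarith)]
          apply Complex.ext
          · exact h₅.symm
          · simp only [hYp]; ring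
      · rw [h₅] at h₃
        refine hpath (z.im - Y p + p) ?_ ?_
        · rw [abs_of_nonneg (by linarith)]; linarith
        · rw [capPath_of_ge hp.le (by linarith)]
          apply Complex.ext
          · exact h₅.symm
          · simp only; ring
      · have hz : |z.re| ≤ p := abs_le.2 ⟨h₁, h₂⟩
        refine hpath z.re (hz.trans (by linarith)) ?_
        rw [capPath_of_abs_le hz, ← h₅]
      · have hq : -1 ≤ z.re / p ∧ z.re / p ≤ 1 :=
          ⟨by rw [le_div_iff₀ hp]; linarith, by rw [div_le_iff₀ hp]; linarith⟩
        refine ⟨(3 - z.re / p) / 4, ⟨by linarith, by linarith⟩, ?_⟩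
        rw [capCurve_of_ge hp hRp (by linarith)]
        apply Complex.ext
        · simp only; field_simp; ring
        · exact h₅.symm
  · rintro z ⟨hz₁, hz₂, hz₃⟩
    rw [abs_lt] at hz₁
    -- The factor `I` makes the avoided rays vertical: `capPath` avoids the ray upwards from `z`,
    -- the top edge the ray downwards.
    refine hasWindingNumber_one (e := I) hc.continuousOn h01 ?_ ?_ ?_ ?_
    · intro t ht
      rw [capCurve_of_le ht.2, mem_slitPlane_iff]
      rcases eq_or_ne (capPath Y p ((4 * t - 1) * (p + R - Y p))).re z.re with e | e
      · have hs : |(4 * t - 1) * (p + R - Y p)| ≤ p := by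
          by_contra! hs
          simp only [capPath] at e
          rcases lt_abs.1 hs with h | h
          · rw [min_eq_right h.le, max_eq_right (by linarith)] at e; linarith
          · rw [min_eq_left (by linarith), max_eq_left (by linarith)] at e; linarith
        rw [capPath_of_abs_le hs] at e ⊢
        simp only at e
        refine Or.inl ?_
        simpa [e] using hz₂
      · exact Or.inr (by simpa [sub_eq_zero] using e)
    · intro t ht
      rw [capCurve_of_ge hp hRp ht.1, mem_slitPlane_iff]
      exact Or.inl (by simpa using hz₃)
    · rw [h01, capCurve_of_ge hp hRp (by norm_num)]; norm_num; linarith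
    · rw [capCurve_of_ge hp hRp le_rfl]; norm_num; linarith

end Cap

/-! ### Explicit formulas for the Jacobian and for `f` -/

section Formulas

variable {k : ℝ}

/-- A real polynomial expression with the sign of the Jacobian determinant. -/
def jacobianSign (k : ℝ) (z : ℂ) : ℝ :=
  (Real.sinh z.im ^ 2 + 1 - Real.cos z.re ^ 2) ^ 2 -
    k ^ 2 * (Real.cos z.re ^ 2 + Real.sinh z.im ^ 2)

theorem continuous_jacobianSign : Continuous (jacobianSign k) := by
  have h₁ := continuous_re
  have h₂ := continuous_im
  unfold jacobianSign
  exact (((((Real.continuous_sinh.comp h₂).pow 2).add continuous_const).sub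
    ((Real.continuous_cos.comp h₁).pow 2)).pow 2).sub
    (continuous_const.mul (((Real.continuous_cos.comp h₁).pow 2).add
      ((Real.continuous_sinh.comp h₂).pow 2)))

theorem normSq_sin (z : ℂ) :
    normSq (sin z) = Real.sinh z.im ^ 2 + 1 - Real.cos z.re ^ 2 := by
  rw [sin_eq, ← ofReal_sin, ← ofReal_cosh, ← ofReal_cos, ← ofReal_sinh, ← ofReal_mul, ← ofReal_mul,
    normSq_add_mul_I]
  nlinarith [Real.sin_sq_add_cos_sq z.re, Real.cosh_sq z.im]

theorem normSq_cos (z : ℂ) :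
    normSq (cos z) = Real.cos z.re ^ 2 + Real.sinh z.im ^ 2 := by
  rw [cos_eq, ← ofReal_sin, ← ofReal_cosh, ← ofReal_cos, ← ofReal_sinh, ← ofReal_mul, ← ofReal_mul,
    sub_eq_add_neg, ← neg_mul, ← ofReal_neg, normSq_add_mul_I]
  nlinarith [Real.sin_sq_add_cos_sq z.re, Real.cosh_sq z.im]

theorem hasDerivAt_lensG {z : ℂ} (hz : sin z ≠ 0) :
    HasDerivAt (lensG k) (k * cos z / sin z ^ 2) z := by
  have h := (hasDerivAt_const z (-(k : ℂ))).div (hasDerivAt_sin z) hz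
  exact h.congr_deriv (by simp)

theorem lensJacobian_pos_iff {z : ℂ} (hz : sin z ≠ 0) :
    0 < lensJacobian k z ↔ 0 < jacobianSign k z := by
  have hs : 0 < normSq (sin z) := normSq_pos.2 hz
  rw [lensJacobian, (hasDerivAt_lensG hz).deriv, ← normSq_eq_norm_sq, normSq_div, normSq_mul,
    map_pow, normSq_ofReal, jacobianSign, ← normSq_sin, ← normSq_cos, sub_pos, sub_pos,
    div_lt_one (by positivity), ← sq]

/-- Where `sin z = 0` the expression equals `-k² |cos z|²`, and `sin` and `cos` have no common zero.
-/
theorem sin_ne_zero_of_jacobianSign_nonneg (hk : k ≠ 0) {z : ℂ} (hz : 0 ≤ jacobianSign k z) :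
    sin z ≠ 0 := by
  intro h
  have h₁ : Real.sinh z.im ^ 2 + 1 - Real.cos z.re ^ 2 = 0 := by rw [← normSq_sin, h, map_zero]
  rw [jacobianSign, h₁] at hz
  have h₂ : 0 < Real.cos z.re ^ 2 + Real.sinh z.im ^ 2 := by nlinarith [sq_nonneg (Real.sinh z.im)]
  have := mul_pos (sq_pos_of_ne_zero hk) h₂
  linarith

/-- The only zero of `sin` in the strip is `0`, where `jacobianSign` is negative; so the exclusion
of the pole is automatic. -/
theorem mem_lensDplus_iff (hk : k ≠ 0) {z : ℂ} :
    z ∈ lensDplus k ↔ |z.re| < Real.pi / 2 ∧ 0 < jacobianSign k z := by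
  constructor
  · rintro ⟨h₁, h₂, h₃⟩
    refine ⟨h₁, (lensJacobian_pos_iff fun h => h₂ ?_).1 h₃⟩
    obtain ⟨n, rfl⟩ := sin_eq_zero_iff.1 h
    have h₁ : |(n : ℝ) * Real.pi| < Real.pi / 2 := by simpa [lensStrip] using h₁
    rw [abs_mul, abs_of_pos Real.pi_pos] at h₁
    have h4 : |(n : ℝ)| < 1 := by
      by_contra! h'
      nlinarith [Real.pi_pos]
    have h5 : |n| < 1 := by exact_mod_cast h4
    simp [Int.abs_lt_one_iff.1 h5]
  · rintro ⟨h₁, h₂⟩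
    have hs := sin_ne_zero_of_jacobianSign_nonneg hk h₂.le
    exact ⟨h₁, fun h => hs (by simp [h]), (lensJacobian_pos_iff hs).2 h₂⟩

theorem isOpen_lensDplus (hk : k ≠ 0) : IsOpen (lensDplus k) := by
  have : lensDplus k = {z : ℂ | |z.re| < Real.pi / 2} ∩ {z | 0 < jacobianSign k z} :=
    Set.ext fun z => mem_lensDplus_iff hk
  rw [this]
  exact (isOpen_lt continuous_re.abs continuous_const).inter
    (isOpen_lt continuous_const continuous_jacobianSign)

theorem jacobianSign_nonneg_of_mem_closure (hk : k ≠ 0) {z : ℂ} (hz : z ∈ closure (lensDplus k)) :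
    0 ≤ jacobianSign k z :=
  closure_minimal (fun _ h => ((mem_lensDplus_iff hk).1 h).2.le)
    (isClosed_le continuous_const continuous_jacobianSign) hz

theorem jacobianSign_neg (z : ℂ) : jacobianSign k (-z) = jacobianSign k z := by
  simp [jacobianSign]

theorem neg_mem_lensDplus_iff (hk : k ≠ 0) {z : ℂ} : -z ∈ lensDplus k ↔ z ∈ lensDplus k := by
  rw [mem_lensDplus_iff hk, mem_lensDplus_iff hk, jacobianSign_neg]; simp

theorem lensMap_neg (z : ℂ) : lensMap k (-z) = -lensMap k z := by
  simp only [lensMap, lensG, sin_neg, div_neg, map_neg]; ring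

theorem continuousAt_lensMap {z : ℂ} (hz : sin z ≠ 0) : ContinuousAt (lensMap k) z :=
  continuousAt_id.add (continuous_conj.continuousAt.comp (hasDerivAt_lensG hz).continuousAt)

theorem lensMap_im (z : ℂ) : (lensMap k z).im = z.im -
    k * (Real.cos z.re * Real.sinh z.im) / (Real.sinh z.im ^ 2 + 1 - Real.cos z.re ^ 2) := by
  have hsin : (sin z).im = Real.cos z.re * Real.sinh z.im := by
    rw [sin_eq, ← ofReal_sin, ← ofReal_cosh, ← ofReal_cos, ← ofReal_sinh, ← ofReal_mul,
      ← ofReal_mul, add_im, im_ofReal_mul, ofReal_im, I_im, zero_add, mul_one]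
  rw [← normSq_sin, lensMap, lensG, add_im, conj_im, ← hsin, neg_div, neg_im, neg_neg, div_eq_mul_inv,
    im_ofReal_mul, inv_im]
  ring

end Formulas

/-! ### The imaginary part of `f` on and beyond the critical curve -/

section CriticalCurve

/-- The function `t s / √(t² + s²)`. -/
def harmonicHypot (t s : ℝ) : ℝ := t * s / √(t ^ 2 + s ^ 2)

theorem harmonicHypot_mono_left {s t t' : ℝ} (hs : 0 < s) (ht : 0 ≤ t) (htt : t ≤ t') :
    harmonicHypot t s ≤ harmonicHypot t' s := by
  have h : 0 < √(t ^ 2 + s ^ 2) := Real.sqrt_pos.2 (by positivity)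
  have h' : 0 < √(t' ^ 2 + s ^ 2) := Real.sqrt_pos.2 (by positivity)
  rw [harmonicHypot, harmonicHypot, div_le_div_iff₀ h h']
  have key : t * √(t' ^ 2 + s ^ 2) ≤ t' * √(t ^ 2 + s ^ 2) := by
    refine (pow_le_pow_iff_left₀ (mul_nonneg ht h'.le) ?_ two_ne_zero).1 ?_
    · exact mul_nonneg (ht.trans htt) h.le
    rw [mul_pow, mul_pow, Real.sq_sqrt (by positivity), Real.sq_sqrt (by positivity)]
    nlinarith [mul_le_mul_of_nonneg_right (pow_le_pow_left₀ ht htt 2) (sq_nonneg s)]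
  nlinarith

theorem harmonicHypot_le {s t : ℝ} (ht : 0 ≤ t) : harmonicHypot t s ≤ t := by
  have h : s ≤ √(t ^ 2 + s ^ 2) := Real.le_sqrt_of_sq_le (by nlinarith)
  rw [harmonicHypot, mul_div_assoc]
  exact mul_le_of_le_one_right ht (div_le_one_of_le₀ h (Real.sqrt_nonneg _))

/-- With `s = sinh y`, the derivative `1 - t³ cosh y / (t² + s²)^(3/2)` is positive because `t⁶ (1 +
s²) < (t² + s²)³`; here `t ≤ 1` gives `t⁶ s² ≤ t⁴ s²`. -/
theorem strictMonoOn_sub_harmonicHypot {t : ℝ} (ht : 0 ≤ t) (ht1 : t ≤ 1) :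
    StrictMonoOn (fun y => y - harmonicHypot t (Real.sinh y)) (Ici 0) := by
  rcases ht.eq_or_lt with rfl | ht
  · intro y _ y' _ h
    simpa [harmonicHypot] using h
  have hpos : ∀ y : ℝ, 0 < t ^ 2 + Real.sinh y ^ 2 := fun y => by positivity
  have hd : ∀ y : ℝ, HasDerivAt (fun y => y - harmonicHypot t (Real.sinh y))
      (1 - t ^ 3 * Real.cosh y / √(t ^ 2 + Real.sinh y ^ 2) ^ 3) y := by
    intro y
    have hsq : 0 < √(t ^ 2 + Real.sinh y ^ 2) := Real.sqrt_pos.2 (hpos y)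
    have e := Real.sq_sqrt (hpos y).le
    have h₁ : HasDerivAt (fun y => t ^ 2 + Real.sinh y ^ 2) (2 * Real.sinh y * Real.cosh y) y := by
      simpa using ((Real.hasDerivAt_sinh y).pow 2).const_add (t ^ 2)
    have h₂ := ((Real.hasDerivAt_sinh y).const_mul t).div (h₁.sqrt (hpos y).ne') hsq.ne'
    refine ((hasDerivAt_id y).sub h₂).congr_deriv ?_
    set r := √(t ^ 2 + Real.sinh y ^ 2)
    field_simp
    linear_combination (-Real.cosh y * t) * e
  refine strictMonoOn_of_deriv_pos (convex_Ici 0)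
    (fun y _ => (hd y).continuousAt.continuousWithinAt) fun y hy => ?_
  rw [interior_Ici, mem_Ioi] at hy
  rw [(hd y).deriv, sub_pos, div_lt_one (pow_pos (Real.sqrt_pos.2 (hpos y)) 3)]
  refine lt_of_pow_lt_pow_left₀ 2 (by positivity) ?_
  have e := Real.sq_sqrt (hpos y).le
  have hs : 0 < Real.sinh y := Real.sinh_pos_iff.2 hy
  have : (√(t ^ 2 + Real.sinh y ^ 2) ^ 3) ^ 2 = (t ^ 2 + Real.sinh y ^ 2) ^ 3 := by
    rw [← pow_mul, mul_comm, pow_mul, e]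
  rw [this, mul_pow, Real.cosh_sq]
  have ht2 : t ^ 2 ≤ 1 := pow_le_one₀ ht.le ht1
  have : t ^ 6 ≤ t ^ 4 := pow_le_pow_of_le_one ht.le ht1 (by norm_num)
  nlinarith [mul_le_mul_of_nonneg_right this (sq_nonneg (Real.sinh y)), pow_pos hs 6,
    mul_pos (pow_pos ht 4) (pow_pos hs 2), mul_pos (pow_pos ht 2) (pow_pos hs 4)]

theorem harmonicHypot_one_sinh_lt {y : ℝ} (hy : 0 < y) : harmonicHypot 1 (Real.sinh y) < y := by
  have := strictMonoOn_sub_harmonicHypot zero_le_one le_rfl (mem_Ici.2 le_rfl) (mem_Ici.2 hy.le) hy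
  simpa [harmonicHypot] using this

variable {k : ℝ} {z : ℂ}

/-- On the critical curve `|sin z|² = k |cos z|`, so `k` cancels in `lensMap_im`. -/
theorem lensMap_im_of_jacobianSign_eq_zero (hk : 0 < k) (hz : jacobianSign k z = 0) :
    (lensMap k z).im = z.im - harmonicHypot (Real.cos z.re) (Real.sinh z.im) := by
  have hA : 0 < Real.sinh z.im ^ 2 + 1 - Real.cos z.re ^ 2 := by
    rw [← normSq_sin]
    exact normSq_pos.2 (sin_ne_zero_of_jacobianSign_nonneg hk.ne' hz.ge)
  have hkB : Real.sinh z.im ^ 2 + 1 - Real.cos z.re ^ 2 =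
      k * √(Real.cos z.re ^ 2 + Real.sinh z.im ^ 2) := by
    rw [jacobianSign, sub_eq_zero] at hz
    rw [← Real.sqrt_sq hA.le, hz, Real.sqrt_mul (sq_nonneg k), Real.sqrt_sq hk.le]
  rw [lensMap_im, hkB, harmonicHypot, mul_div_mul_left _ _ hk.ne']

/-- Nonnegative Jacobian means `k |cos z| ≤ |sin z|²`, which turns the formula on the critical curve
into a lower bound. -/
theorem le_lensMap_im (hk : 0 < k) (hz : 0 ≤ jacobianSign k z) (hx : 0 ≤ Real.cos z.re)
    (hy : 0 ≤ z.im) :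
    z.im - harmonicHypot (Real.cos z.re) (Real.sinh z.im) ≤ (lensMap k z).im := by
  have hs := Real.sinh_nonneg_iff.2 hy
  have hA : 0 < Real.sinh z.im ^ 2 + 1 - Real.cos z.re ^ 2 := by
    rw [← normSq_sin]
    exact normSq_pos.2 (sin_ne_zero_of_jacobianSign_nonneg hk.ne' hz)
  have hkB : k * √(Real.cos z.re ^ 2 + Real.sinh z.im ^ 2) ≤
      Real.sinh z.im ^ 2 + 1 - Real.cos z.re ^ 2 := by
    rw [jacobianSign, sub_nonneg] at hz
    rw [← Real.sqrt_sq hA.le, ← Real.sqrt_sq hk.le, ← Real.sqrt_mul (sq_nonneg _)]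
    exact Real.sqrt_le_sqrt hz
  rw [lensMap_im]
  refine sub_le_sub_left ?_ _
  rcases (Real.sqrt_nonneg (Real.cos z.re ^ 2 + Real.sinh z.im ^ 2)).eq_or_lt with h | h
  · have h0 : Real.cos z.re ^ 2 + Real.sinh z.im ^ 2 ≤ 0 := Real.sqrt_eq_zero'.1 h.symm
    have : Real.cos z.re = 0 := by nlinarith
    simp [harmonicHypot, this]
  · rw [harmonicHypot, div_le_div_iff₀ hA h]
    nlinarith [mul_le_mul_of_nonneg_left hkB (mul_nonneg hx hs)]

theorem sub_one_le_lensMap_im (hk : 0 < k) (hz : 0 ≤ jacobianSign k z) (hx : 0 ≤ Real.cos z.re)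
    (hy : 0 ≤ z.im) : z.im - 1 ≤ (lensMap k z).im := by
  have := le_lensMap_im hk hz hx hy
  have := harmonicHypot_le (s := Real.sinh z.im) hx
  linarith [Real.cos_le_one z.re]

/-- The worst case is `cos x = 1`, where `tanh y < y` remains. This positivity lowers the final
bound from `4` to `3`. -/
theorem lensMap_im_pos (hk : 0 < k) (hz : 0 ≤ jacobianSign k z) (hx : 0 ≤ Real.cos z.re)
    (hy : 0 < z.im) : 0 < (lensMap k z).im := by
  have h₁ := le_lensMap_im hk hz hx hy.le
  have h₂ := harmonicHypot_mono_left (Real.sinh_pos_iff.2 hy) hx (Real.cos_le_one z.re)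
  linarith [harmonicHypot_one_sinh_lt hy]

theorem lensMap_im_of_re_eq {z : ℂ} (hz : |z.re| = Real.pi / 2) : (lensMap k z).im = z.im := by
  have : Real.cos z.re = 0 := by rw [← Real.cos_abs, hz, Real.cos_pi_div_two]
  rw [lensMap_im, this]; simp

end CriticalCurve

theorem abs_lt_iff_sinh_sq_lt {y b : ℝ} (hb : 0 ≤ b) :
    |y| < b ↔ Real.sinh y ^ 2 < Real.sinh b ^ 2 := by
  rw [sq_lt_sq, Real.abs_sinh, Real.abs_sinh, Real.sinh_lt_sinh, abs_of_nonneg hb]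

/-! ### The critical curve that bounds the lens -/

section SideGraph

variable {k : ℝ}

/-- The smaller root `u` of `(C - u)² = k² (C - 1 + u)`. -/
def sideRoot (k C : ℝ) : ℝ := C + k ^ 2 / 2 - k / 2 * √(k ^ 2 + 8 * C - 4)

/-- The smaller root `C` of `C² = k² (C - 1)`. -/
def sideEnd (k : ℝ) : ℝ := (k ^ 2 - k * √(k ^ 2 - 4)) / 2

/-- The height of the lateral components of `D⁺`. -/
def sideHeight (k : ℝ) : ℝ := Real.arsinh √(sideEnd k - 1)

/-- The critical curve that bounds the right component of `D⁺`, as a graph over the imaginary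
axis. -/
def sideGraph (k y : ℝ) : ℝ := Real.arccos √(sideRoot k (Real.sinh y ^ 2 + 1))

theorem continuous_sideGraph : Continuous (sideGraph k) := by
  unfold sideGraph sideRoot
  have := Real.continuous_sinh
  exact Real.continuous_arccos.comp (by fun_prop)

theorem sideRoot_mul {C u : ℝ} (hC : 1 ≤ C) :
    (C - u) ^ 2 - k ^ 2 * (C - 1 + u) =
      (sideRoot k C - u) * (C + k ^ 2 / 2 + k / 2 * √(k ^ 2 + 8 * C - 4) - u) := by
  have e := Real.sq_sqrt (show 0 ≤ k ^ 2 + 8 * C - 4 by nlinarith)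
  rw [sideRoot]
  linear_combination (k ^ 2 / 4) * e

/-- The larger root exceeds `1 ≥ cos² x`, so only the smaller root decides the sign of the Jacobian.
-/
theorem sideRoot_conj_pos (hk : 2 ≤ k) {C u : ℝ} (hC : 1 ≤ C) (hu : u ≤ 1) :
    0 < C + k ^ 2 / 2 + k / 2 * √(k ^ 2 + 8 * C - 4) - u := by
  have : 0 ≤ k / 2 * √(k ^ 2 + 8 * C - 4) := by positivity
  nlinarith

theorem lt_sideRoot_iff (hk : 2 ≤ k) {C u : ℝ} (hC : 1 ≤ C) (hu : u ≤ 1) :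
    u < sideRoot k C ↔ 0 < (C - u) ^ 2 - k ^ 2 * (C - 1 + u) := by
  rw [sideRoot_mul hC, mul_pos_iff_of_pos_right (sideRoot_conj_pos hk hC hu), sub_pos]

theorem sideRoot_lt_one (hk : 2 ≤ k) {C : ℝ} (hC : 1 ≤ C) (hC' : C ≤ k ^ 2 / 2) :
    sideRoot k C < 1 := by
  by_contra! h
  have h₁ := sideRoot_mul (k := k) (u := 1) hC
  have h₂ := mul_nonneg (sub_nonneg.2 h) (sideRoot_conj_pos hk hC le_rfl).le
  rw [← h₁] at h₂
  nlinarith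

theorem sideEnd_mul (hk : 2 ≤ k) (C : ℝ) :
    C ^ 2 - k ^ 2 * (C - 1) = (sideEnd k - C) * ((k ^ 2 + k * √(k ^ 2 - 4)) / 2 - C) := by
  have e := Real.sq_sqrt (show 0 ≤ k ^ 2 - 4 by nlinarith)
  rw [sideEnd]
  linear_combination (k ^ 2 / 4) * e

theorem sideEnd_le (hk : 2 ≤ k) : sideEnd k ≤ k ^ 2 / 2 := by
  have : 0 ≤ k * √(k ^ 2 - 4) := by positivity
  rw [sideEnd]; linarith

theorem one_lt_sideEnd (hk : 2 ≤ k) : 1 < sideEnd k := by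
  have h₁ := sideEnd_mul hk 1
  have h₂ : 0 < (k ^ 2 + k * √(k ^ 2 - 4)) / 2 - 1 := by
    have : 0 ≤ k * √(k ^ 2 - 4) := by positivity
    nlinarith
  by_contra! h
  nlinarith [mul_nonneg (sub_nonneg.2 h) h₂.le]

/-- At `C = 2` the quadratic is `4 - k² ≤ 0`, so `2` cannot lie below both roots. The bound keeps
the lens in the range where `sideRoot_anti` applies. -/
theorem sideEnd_le_two (hk : 2 ≤ k) : sideEnd k ≤ 2 := by
  have h₁ := sideEnd_mul hk 2
  by_contra! h
  have h₂ : 0 ≤ k * √(k ^ 2 - 4) := by positivity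
  have h₃ : 2 < (k ^ 2 + k * √(k ^ 2 - 4)) / 2 := by
    have := sideEnd_le hk; linarith
  have := mul_pos (sub_pos.2 h) (sub_pos.2 h₃)
  nlinarith

theorem sideRoot_pos_iff (hk : 2 ≤ k) {C : ℝ} (hC : 1 ≤ C) (hC' : C < k ^ 2 / 2) :
    0 < sideRoot k C ↔ C < sideEnd k := by
  have h₂ : 0 < (k ^ 2 + k * √(k ^ 2 - 4)) / 2 - C := by
    have : 0 ≤ k * √(k ^ 2 - 4) := by positivity
    linarith
  rw [lt_sideRoot_iff hk hC zero_le_one, sub_zero, add_zero, sideEnd_mul hk,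
    mul_pos_iff_of_pos_right h₂, sub_pos]

theorem sideRoot_sideEnd (hk : 2 ≤ k) : sideRoot k (sideEnd k) = 0 := by
  have h := sideRoot_mul (k := k) (u := 0) (one_lt_sideEnd hk).le
  rw [sub_zero, add_zero, sideEnd_mul hk, sub_self, zero_mul, sub_zero] at h
  exact (mul_eq_zero.1 h.symm).resolve_right
    (sideRoot_conj_pos hk (one_lt_sideEnd hk).le zero_le_one).ne'

theorem sideRoot_nonneg (hk : 2 ≤ k) {C : ℝ} (hC : 1 ≤ C) (hC' : C ≤ sideEnd k) :
    0 ≤ sideRoot k C := by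
  rcases hC'.eq_or_lt with rfl | h
  · rw [sideRoot_sideEnd hk]
  · exact ((sideRoot_pos_iff hk hC (h.trans_le (sideEnd_le hk))).2 h).le

/-- The derivative in `C` is `1 - 2 k / √(k² + 8 C - 4)`, and for `C ≤ 2` the root is at most `2 k`
exactly because `k ≥ 2`. -/
theorem sideRoot_anti (hk : 2 ≤ k) {C C' : ℝ} (hC : 1 ≤ C) (hCC : C ≤ C') (hC' : C' ≤ 2) :
    sideRoot k C' ≤ sideRoot k C := by
  have e := Real.sq_sqrt (show 0 ≤ k ^ 2 + 8 * C - 4 by nlinarith)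
  have e' := Real.sq_sqrt (show 0 ≤ k ^ 2 + 8 * C' - 4 by nlinarith)
  have hle : √(k ^ 2 + 8 * C - 4) ≤ √(k ^ 2 + 8 * C' - 4) := Real.sqrt_le_sqrt (by linarith)
  have hub : √(k ^ 2 + 8 * C' - 4) ≤ 2 * k := Real.sqrt_le_iff.2 ⟨by linarith, by nlinarith⟩
  rw [sideRoot, sideRoot]
  nlinarith [mul_nonneg (sub_nonneg.2 hle) (sub_nonneg.2 hub),
    mul_nonneg (sub_nonneg.2 hle) (sub_nonneg.2 (hle.trans hub))]

theorem sinh_sideHeight_sq (hk : 2 ≤ k) : Real.sinh (sideHeight k) ^ 2 = sideEnd k - 1 := by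
  rw [sideHeight, Real.sinh_arsinh, Real.sq_sqrt (by linarith [one_lt_sideEnd hk])]

theorem sideHeight_pos (hk : 2 ≤ k) : 0 < sideHeight k :=
  Real.arsinh_pos_iff.2 (Real.sqrt_pos.2 (by linarith [one_lt_sideEnd hk]))

theorem abs_lt_sideHeight_iff (hk : 2 ≤ k) {y : ℝ} :
    |y| < sideHeight k ↔ Real.sinh y ^ 2 + 1 < sideEnd k := by
  rw [abs_lt_iff_sinh_sq_lt (sideHeight_pos hk).le, sinh_sideHeight_sq hk, lt_sub_iff_add_lt]

theorem sinh_sq_le_of_abs_le (hk : 2 ≤ k) {y : ℝ} (hy : |y| ≤ sideHeight k) :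
    Real.sinh y ^ 2 + 1 ≤ sideEnd k := by
  rcases hy.lt_or_eq with h | h
  · exact ((abs_lt_sideHeight_iff hk).1 h).le
  · rw [← sq_abs, Real.abs_sinh, h, sinh_sideHeight_sq hk]; linarith

theorem one_le_sinh_sq_add_one (y : ℝ) : 1 ≤ Real.sinh y ^ 2 + 1 := by
  linarith [sq_nonneg (Real.sinh y)]

theorem sideGraph_neg (y : ℝ) : sideGraph k (-y) = sideGraph k y := by
  simp [sideGraph]

theorem sideGraph_sideHeight (hk : 2 ≤ k) : sideGraph k (sideHeight k) = Real.pi / 2 := by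
  rw [sideGraph, sinh_sideHeight_sq hk, sub_add_cancel, sideRoot_sideEnd hk, Real.sqrt_zero,
    Real.arccos_zero]

theorem sideGraph_lt (hk : 2 ≤ k) {y : ℝ} (hy : |y| < sideHeight k) :
    sideGraph k y < Real.pi / 2 := by
  have h := (abs_lt_sideHeight_iff hk).1 hy
  rw [sideGraph, Real.arccos_lt_pi_div_two, Real.sqrt_pos]
  exact (sideRoot_pos_iff hk (one_le_sinh_sq_add_one y) (h.trans_le (sideEnd_le hk))).2 h

theorem cos_sideGraph (hk : 2 ≤ k) {y : ℝ} (hy : |y| ≤ sideHeight k) :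
    Real.cos (sideGraph k y) = √(sideRoot k (Real.sinh y ^ 2 + 1)) := by
  have h := sinh_sq_le_of_abs_le hk hy
  refine Real.cos_arccos (by linarith [Real.sqrt_nonneg (sideRoot k (Real.sinh y ^ 2 + 1))])
    (Real.sqrt_le_one.2 ?_)
  exact (sideRoot_lt_one hk (one_le_sinh_sq_add_one y) (h.trans (sideEnd_le hk))).le

theorem jacobianSign_eq (k : ℝ) (z : ℂ) : jacobianSign k z =
    ((Real.sinh z.im ^ 2 + 1) - Real.cos z.re ^ 2) ^ 2 -
      k ^ 2 * ((Real.sinh z.im ^ 2 + 1) - 1 + Real.cos z.re ^ 2) := by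
  rw [jacobianSign]; ring

theorem jacobianSign_sideGraph (hk : 2 ≤ k) {y : ℝ} (hy : |y| ≤ sideHeight k) :
    jacobianSign k ⟨sideGraph k y, y⟩ = 0 := by
  rw [jacobianSign_eq, sideRoot_mul (one_le_sinh_sq_add_one _), cos_sideGraph hk hy,
    Real.sq_sqrt (sideRoot_nonneg hk (one_le_sinh_sq_add_one _) (sinh_sq_le_of_abs_le hk hy)),
    sub_self, zero_mul]

theorem cos_sq_le_one (x : ℝ) : Real.cos x ^ 2 ≤ 1 := by
  nlinarith [Real.sin_sq_add_cos_sq x]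

/-- The right component of `D⁺`. -/
theorem mem_lensRegion_iff (hk : 2 ≤ k) {z : ℂ} :
    z ∈ lensRegion (sideGraph k) (sideHeight k) (Real.pi / 2) ↔
      z ∈ lensDplus k ∧ 0 < z.re ∧ Real.sinh z.im ^ 2 + 1 < k ^ 2 / 2 := by
  have hC := one_le_sinh_sq_add_one z.im
  rw [mem_lensDplus_iff (by positivity), jacobianSign_eq, ← lt_sideRoot_iff hk hC (cos_sq_le_one _)]
  constructor
  · rintro ⟨h₁, h₂, h₃⟩
    have hx : 0 < z.re := (Real.arccos_nonneg _).trans_lt h₂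
    refine ⟨⟨abs_lt.2 ⟨by linarith [Real.pi_pos], h₃⟩, ?_⟩, hx,
      ((abs_lt_sideHeight_iff hk).1 h₁).trans_le (sideEnd_le hk)⟩
    have h := Real.cos_lt_cos_of_nonneg_of_le_pi_div_two (Real.arccos_nonneg _) h₃.le h₂
    have h' : Real.cos z.re < √(sideRoot k (Real.sinh z.im ^ 2 + 1)) := by
      rw [← cos_sideGraph hk h₁.le]; exact h
    have h0 : 0 < Real.cos z.re := Real.cos_pos_of_mem_Ioo ⟨by linarith, h₃⟩
    exact (Real.lt_sqrt h0.le).1 h'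
  · rintro ⟨⟨h₁, h₂⟩, h₃, h₄⟩
    have hU : 0 < sideRoot k (Real.sinh z.im ^ 2 + 1) := (sq_nonneg _).trans_lt h₂
    have hy : |z.im| < sideHeight k :=
      (abs_lt_sideHeight_iff hk).2 ((sideRoot_pos_iff hk hC h₄).1 hU)
    refine ⟨hy, ?_, (abs_lt.1 h₁).2⟩
    have h0 : 0 ≤ Real.cos z.re := Real.cos_nonneg_of_mem_Icc
      ⟨(abs_lt.1 h₁).1.le, (abs_lt.1 h₁).2.le⟩
    have h5 : Real.cos z.re < Real.cos (sideGraph k z.im) := by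
      rw [cos_sideGraph hk hy.le]; exact (Real.lt_sqrt h0).2 h₂
    by_contra! h6
    have := Real.cos_le_cos_of_nonneg_of_le_pi h₃.le (Real.arccos_le_pi _) h6
    exact absurd h5 this.not_gt

theorem lensMap_sideGraph_im (hk : 2 ≤ k) {y : ℝ} (hy : |y| ≤ sideHeight k) :
    (lensMap k ⟨sideGraph k y, y⟩).im =
      y - harmonicHypot √(sideRoot k (Real.sinh y ^ 2 + 1)) (Real.sinh y) := by
  rw [lensMap_im_of_jacobianSign_eq_zero (by linarith) (jacobianSign_sideGraph hk hy),
    cos_sideGraph hk hy]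

/-- For `y ≥ 0` two effects add up: for fixed `t` the function `y - harmonicHypot t (sinh y)`
increases, and along the curve `t = cos x` decreases, which lowers `harmonicHypot`. Negative `y`
follow by oddness. -/
theorem strictMonoOn_lensMap_sideGraph (hk : 2 ≤ k) :
    StrictMonoOn (fun y => (lensMap k ⟨sideGraph k y, y⟩).im)
      (Icc (-sideHeight k) (sideHeight k)) := by
  set g : ℝ → ℝ := fun y => y - harmonicHypot √(sideRoot k (Real.sinh y ^ 2 + 1)) (Real.sinh y)
    with hg
  have hgn : ∀ y, g (-y) = -g y := fun y => by
    simp only [hg, harmonicHypot, Real.sinh_neg, neg_sq]; ring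
  have hg0 : g 0 = 0 := by simp [hg, harmonicHypot]
  have hpos : StrictMonoOn g (Icc 0 (sideHeight k)) := by
    intro y hy y' hy' hyy
    have hC := sinh_sq_le_of_abs_le hk (y := y') (by rw [abs_of_nonneg hy'.1]; exact hy'.2)
    have hC' := hC.trans (sideEnd_le_two hk)
    have hs : 0 ≤ Real.sinh y := Real.sinh_nonneg_iff.2 hy.1
    have hss : Real.sinh y < Real.sinh y' := Real.sinh_lt_sinh.2 hyy
    have hCC : Real.sinh y ^ 2 + 1 ≤ Real.sinh y' ^ 2 + 1 := by nlinarith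
    have hU := sideRoot_anti hk (one_le_sinh_sq_add_one y) hCC hC'
    have h1 := (sideRoot_lt_one hk (one_le_sinh_sq_add_one y)
      (hCC.trans (hC.trans (sideEnd_le hk)))).le
    have m₁ := strictMonoOn_sub_harmonicHypot (Real.sqrt_nonneg _) (Real.sqrt_le_one.2 h1)
      (mem_Ici.2 hy.1) (mem_Ici.2 hy'.1) hyy
    have m₂ := harmonicHypot_mono_left (hs.trans_lt hss) (Real.sqrt_nonneg _) (Real.sqrt_le_sqrt hU)
    simp only [hg] at *
    linarith
  have h0 : (0 : ℝ) ∈ Icc 0 (sideHeight k) := ⟨le_rfl, (sideHeight_pos hk).le⟩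
  have hmono : StrictMonoOn g (Icc (-sideHeight k) (sideHeight k)) := by
    intro y hy y' hy' hyy
    rcases le_total 0 y with h | h
    · exact hpos ⟨h, hy.2⟩ ⟨h.trans hyy.le, hy'.2⟩ hyy
    rcases le_total y' 0 with h' | h'
    · have := hpos (a := -y') (b := -y) ⟨by linarith, by linarith [hy'.1]⟩
        ⟨by linarith, by linarith [hy.1]⟩ (by linarith)
      rw [hgn, hgn] at this; linarith
    · have a₁ : 0 ≤ g y' := by
        rw [← hg0]; exact hpos.monotoneOn h0 ⟨h', hy'.2⟩ h'
      have a₂ : 0 ≤ g (-y) := by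
        rw [← hg0]; exact hpos.monotoneOn h0 ⟨by linarith, by linarith [hy.1]⟩ (by linarith)
      rw [hgn] at a₂
      rcases h.eq_or_lt with rfl | h
      · exact hpos h0 ⟨h', hy'.2⟩ hyy
      · have := hpos (b := -y) h0 ⟨by linarith, by linarith [hy.1]⟩ (by linarith)
        rw [hgn, hg0] at this; linarith
  exact hmono.congr fun y hy => (lensMap_sideGraph_im hk (abs_le.2 hy)).symm

end SideGraph

/-! ### The critical curve that bounds the cap -/

section TopGraph

variable {k : ℝ}

/-- The modulus of `cos z` on the critical curve that bounds the upper component of `D⁺`. -/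
def topModulus (k x : ℝ) : ℝ := (k + √(k ^ 2 - 4 + 8 * Real.cos x ^ 2)) / 2

/-- The critical curve that bounds the upper component of `D⁺`, as a graph over the real axis. -/
def topGraph (k x : ℝ) : ℝ := Real.arsinh √((topModulus k x ^ 2 + k * topModulus k x - 1) / 2)

theorem continuous_topGraph : Continuous (topGraph k) := by
  have := Real.continuous_cos
  unfold topGraph topModulus
  exact Continuous.arsinh (by fun_prop)

theorem topModulus_neg (x : ℝ) : topModulus k (-x) = topModulus k x := by simp [topModulus]

theorem topGraph_neg (x : ℝ) : topGraph k (-x) = topGraph k x := by simp [topGraph, topModulus_neg]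

/-- Writing `β = |cos z|`, the equations `S + u = β²` and `S + 1 - u = k β` give `2 u = β² - k β +
1` and `2 S = β² + k β - 1`; so `β` parametrizes the curve. -/
theorem two_mul_cos_sq_eq (hk : 2 ≤ k) (x : ℝ) :
    2 * Real.cos x ^ 2 = topModulus k x ^ 2 - k * topModulus k x + 1 := by
  have e := Real.sq_sqrt (show 0 ≤ k ^ 2 - 4 + 8 * Real.cos x ^ 2 by nlinarith)
  rw [topModulus]
  linear_combination (-1 / 4) * e

theorem half_le_topModulus (x : ℝ) : k / 2 ≤ topModulus k x := by
  rw [topModulus]; linarith [Real.sqrt_nonneg (k ^ 2 - 4 + 8 * Real.cos x ^ 2)]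

theorem sinh_topGraph_sq (hk : 2 ≤ k) (x : ℝ) :
    Real.sinh (topGraph k x) ^ 2 = (topModulus k x ^ 2 + k * topModulus k x - 1) / 2 := by
  rw [topGraph, Real.sinh_arsinh, Real.sq_sqrt]
  nlinarith [half_le_topModulus (k := k) x]

theorem topGraph_pos (hk : 2 ≤ k) (x : ℝ) : 0 < topGraph k x := by
  rw [topGraph, Real.arsinh_pos_iff, Real.sqrt_pos]
  nlinarith [half_le_topModulus (k := k) x]

theorem topGraph_lt_iff (hk : 2 ≤ k) {x y : ℝ} (hy : 0 < y) :
    topGraph k x < y ↔ (topModulus k x ^ 2 + k * topModulus k x - 1) / 2 < Real.sinh y ^ 2 := by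
  rw [← sinh_topGraph_sq hk, ← abs_lt_iff_sinh_sq_lt hy.le, abs_of_pos (topGraph_pos hk x)]

/-- For given `x` the two candidates for `β` are the roots of `β² - k β + 1 = 2 cos² x`, whose sum
is `k`; they yield the two roots in `sinh² y`. -/
theorem jacobianSign_mul (hk : 2 ≤ k) (x y : ℝ) : jacobianSign k ⟨x, y⟩ =
    (Real.sinh y ^ 2 - (topModulus k x ^ 2 + k * topModulus k x - 1) / 2) *
      (Real.sinh y ^ 2 - ((k - topModulus k x) ^ 2 + k * (k - topModulus k x) - 1) / 2) := by
  have e := two_mul_cos_sq_eq hk x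
  have e' : Real.cos x ^ 2 = (topModulus k x ^ 2 - k * topModulus k x + 1) / 2 := by linarith
  rw [jacobianSign]
  simp only
  rw [e']
  ring

theorem jacobianSign_topGraph (hk : 2 ≤ k) (x : ℝ) : jacobianSign k ⟨x, topGraph k x⟩ = 0 := by
  rw [jacobianSign_mul hk, sinh_topGraph_sq hk, sub_self, zero_mul]

/-- The upper component of `D⁺`. -/
theorem topGraph_lt_im_iff (hk : 2 ≤ k) {z : ℂ} :
    (|z.re| < Real.pi / 2 ∧ topGraph k z.re < z.im) ↔
      z ∈ lensDplus k ∧ 0 < z.im ∧ k ^ 2 / 2 < Real.sinh z.im ^ 2 + 1 := by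
  have e := two_mul_cos_sq_eq hk z.re
  have h2 := half_le_topModulus (k := k) z.re
  have hu := cos_sq_le_one z.re
  -- This says precisely that the smaller root in `sinh² y` is at most `k² / 2 - 1`; hence that
  -- level separates the two roots.
  have h3 : Real.cos z.re ^ 2 ≤ k * (topModulus k z.re - k / 2) := by
    have h4 : Real.cos z.re ^ 2 ≤ √(k ^ 2 - 4 + 8 * Real.cos z.re ^ 2) :=
      Real.le_sqrt_of_sq_le (by nlinarith [sq_nonneg (Real.cos z.re)])
    have h5 : topModulus k z.re - k / 2 = √(k ^ 2 - 4 + 8 * Real.cos z.re ^ 2) / 2 := by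
      rw [topModulus]; ring
    rw [h5]
    nlinarith [Real.sqrt_nonneg (k ^ 2 - 4 + 8 * Real.cos z.re ^ 2)]
  have hS' : ((k - topModulus k z.re) ^ 2 + k * (k - topModulus k z.re) - 1) / 2 ≤ k ^ 2 / 2 - 1 := by
    nlinarith
  have hS : k ^ 2 / 2 - 1 ≤ (topModulus k z.re ^ 2 + k * topModulus k z.re - 1) / 2 := by
    nlinarith [sq_nonneg (Real.cos z.re)]
  rw [mem_lensDplus_iff (by positivity), show z = ⟨z.re, z.im⟩ from rfl, jacobianSign_mul hk]
  simp only
  constructor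
  · rintro ⟨h₁, h₂⟩
    have hy := (topGraph_pos hk z.re).trans h₂
    rw [topGraph_lt_iff hk hy] at h₂
    exact ⟨⟨h₁, mul_pos (by linarith) (by linarith)⟩, hy, by linarith⟩
  · rintro ⟨⟨h₁, h₂⟩, hy, h₃⟩
    refine ⟨h₁, (topGraph_lt_iff hk hy).2 (sub_pos.1 ?_)⟩
    exact (pos_iff_pos_of_mul_pos h₂).2 (by linarith)

theorem cubic_lt_quintic {τ β : ℝ} (hτ : 0 < τ) (hβ : τ ≤ β - 1) :
    τ * β * (3 * β ^ 2 + 1 - τ ^ 2) < (β + 1) * (β ^ 4 - β ^ 2 + τ ^ 2) := by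
  -- In `τ` and `δ` the difference of the two sides is a polynomial with only positive coefficients.
  obtain ⟨δ, hδ, rfl⟩ : ∃ δ, 0 ≤ δ ∧ β = 1 + τ + δ := ⟨β - 1 - τ, by linarith, by ring⟩
  rw [← sub_pos]
  ring_nf
  positivity

end TopGraph

/-! ### Monotonicity of `Im f` along the boundary of the cap -/

section TopImage

variable {k : ℝ}

/-- The imaginary part of `f` on the upper critical curve, in terms of `β = |cos z|`. -/
def topImage (k β : ℝ) : ℝ := Real.arsinh √((β ^ 2 + k * β - 1) / 2) -
  √((β ^ 2 - k * β + 1) / 2) * √((β ^ 2 + k * β - 1) / 2) / β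

theorem hasDerivAt_topImage {β : ℝ} (hβ : 0 < β) (hq : 0 < β ^ 2 - k * β + 1)
    (hS : 0 < β ^ 2 + k * β - 1) :
    HasDerivAt (topImage k)
      ((√((β ^ 2 - k * β + 1) / 2) * ((2 * β + k) * β ^ 2) -
        √(1 + (β ^ 2 + k * β - 1) / 2) * (β ^ 4 - k * β + 1)) /
        (4 * √((β ^ 2 - k * β + 1) / 2) * √((β ^ 2 + k * β - 1) / 2) *
          √(1 + (β ^ 2 + k * β - 1) / 2) * β ^ 2)) β := by
  have dq : HasDerivAt (fun β : ℝ => (β ^ 2 - k * β + 1) / 2) ((2 * β - k) / 2) β := by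
    simpa using ((((hasDerivAt_id β).pow 2).sub ((hasDerivAt_id β).const_mul k)).add_const 1).div_const 2
  have dS : HasDerivAt (fun β : ℝ => (β ^ 2 + k * β - 1) / 2) ((2 * β + k) / 2) β := by
    simpa using ((((hasDerivAt_id β).pow 2).add ((hasDerivAt_id β).const_mul k)).sub_const 1).div_const 2
  have hq2 : 0 < (β ^ 2 - k * β + 1) / 2 := by linarith
  have hS2 : 0 < (β ^ 2 + k * β - 1) / 2 := by linarith
  have dt := dq.sqrt hq2.ne'
  have ds := dS.sqrt hS2.ne'
  have ht := Real.sqrt_pos.2 hq2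
  have hs := Real.sqrt_pos.2 hS2
  have et := Real.sq_sqrt hq2.le
  have es := Real.sq_sqrt hS2.le
  refine (ds.arsinh.sub ((dt.mul ds).div (hasDerivAt_id β) hβ.ne')).congr_deriv ?_
  simp only [smul_eq_mul, Pi.mul_apply, id_eq, es]
  have hc : 0 < √(1 + (β ^ 2 + k * β - 1) / 2) := Real.sqrt_pos.2 (by linarith)
  set t := √((β ^ 2 - k * β + 1) / 2)
  set s := √((β ^ 2 + k * β - 1) / 2)
  set c := √(1 + (β ^ 2 + k * β - 1) / 2)
  field_simp
  rw [es, et]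
  ring

/-- Put `τ² = β² - k β + 1` and eliminate `k`. Since `k ≥ 2`, one has `τ ≤ β - 1` and `√(β² + k β +
1) ≥ β + 1`, and the sign of the numerator, scaled by `√2`, follows from `cubic_lt_quintic`. -/
theorem deriv_topImage_neg (hk : 2 ≤ k) {β : ℝ} (hβ : k / 2 ≤ β) (hq : 0 < β ^ 2 - k * β + 1) :
    deriv (topImage k) β < 0 := by
  have hβ1 : 1 ≤ β := by linarith
  have hS : 0 < β ^ 2 + k * β - 1 := by nlinarith
  rw [(hasDerivAt_topImage (by linarith) hq hS).deriv]
  have hq2 : 0 < (β ^ 2 - k * β + 1) / 2 := by linarith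
  have hS2 : 0 < (β ^ 2 + k * β - 1) / 2 := by linarith
  have ht := Real.sqrt_pos.2 hq2
  have hs := Real.sqrt_pos.2 hS2
  have hc : 0 < √(1 + (β ^ 2 + k * β - 1) / 2) := Real.sqrt_pos.2 (by linarith)
  refine div_neg_of_neg_of_pos ?_ (by positivity)
  have eτ : √((β ^ 2 - k * β + 1) / 2) * √2 = √(β ^ 2 - k * β + 1) := by
    rw [← Real.sqrt_mul hq2.le, div_mul_cancel₀ _ two_ne_zero]
  have ed : √(1 + (β ^ 2 + k * β - 1) / 2) * √2 = √(β ^ 2 + k * β + 1) := by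
    rw [← Real.sqrt_mul (by linarith)]
    congr 1; ring
  have e := Real.sq_sqrt hq.le
  have hτ : √(β ^ 2 - k * β + 1) ≤ β - 1 :=
    Real.sqrt_le_iff.2 ⟨by linarith, by nlinarith⟩
  have hd : β + 1 ≤ √(β ^ 2 + k * β + 1) := Real.le_sqrt_of_sq_le (by nlinarith)
  have key := cubic_lt_quintic (Real.sqrt_pos.2 hq) hτ
  rw [e] at key
  have hpos : 0 < β ^ 4 - β ^ 2 + (β ^ 2 - k * β + 1) := by
    nlinarith [mul_nonneg (sq_nonneg β) (sub_nonneg.2 (one_le_pow₀ hβ1 (n := 2)))]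
  have key2 := mul_le_mul_of_nonneg_right hd hpos.le
  have h2 : 0 < √(2 : ℝ) := by positivity
  refine neg_of_mul_neg_left (b := √2) ?_ h2.le
  rw [sub_mul, mul_right_comm, eτ, mul_right_comm, ed]
  nlinarith

theorem strictAntiOn_topImage (hk : 2 ≤ k) :
    StrictAntiOn (topImage k) (Ici ((k + √(k ^ 2 - 4)) / 2)) := by
  have e := Real.sq_sqrt (show 0 ≤ k ^ 2 - 4 by nlinarith)
  have h0 := Real.sqrt_nonneg (k ^ 2 - 4)
  refine strictAntiOn_of_deriv_neg (convex_Ici _) ?_ fun β hβ => ?_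
  · unfold topImage
    refine ContinuousOn.sub (Continuous.continuousOn (Continuous.arsinh (by fun_prop)))
      (ContinuousOn.div (by fun_prop) continuousOn_id fun β hβ => ?_)
    rw [mem_Ici] at hβ
    linarith
  · rw [interior_Ici, mem_Ioi] at hβ
    refine deriv_topImage_neg hk (by linarith) ?_
    have h₁ : 0 < β - (k + √(k ^ 2 - 4)) / 2 := by linarith
    have h₂ : 0 < β - (k - √(k ^ 2 - 4)) / 2 := by linarith
    nlinarith [mul_pos h₁ h₂]

theorem lensMap_topGraph_im (hk : 2 ≤ k) {x : ℝ} (hx : |x| ≤ Real.pi / 2) :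
    (lensMap k ⟨x, topGraph k x⟩).im = topImage k (topModulus k x) := by
  have hc : 0 ≤ Real.cos x := Real.cos_nonneg_of_mem_Icc (abs_le.1 hx)
  have e := two_mul_cos_sq_eq hk x
  have h := half_le_topModulus (k := k) x
  have et : Real.cos x = √((topModulus k x ^ 2 - k * topModulus k x + 1) / 2) := by
    rw [← e, mul_div_cancel_left₀ _ two_ne_zero, Real.sqrt_sq hc]
  have es : Real.sinh (topGraph k x) = √((topModulus k x ^ 2 + k * topModulus k x - 1) / 2) := by
    rw [topGraph, Real.sinh_arsinh]
  have eβ : √(Real.cos x ^ 2 + Real.sinh (topGraph k x) ^ 2) = topModulus k x := by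
    rw [sinh_topGraph_sq hk, ← Real.sqrt_sq (show 0 ≤ topModulus k x by linarith)]
    congr 1
    rw [Real.sqrt_sq (show 0 ≤ topModulus k x by linarith)]
    linarith
  rw [lensMap_im_of_jacobianSign_eq_zero (by linarith) (jacobianSign_topGraph hk x)]
  simp only [harmonicHypot]
  rw [eβ, topImage, es, et]
  rfl

/-- As `x` grows from `0` to `π / 2`, the modulus `β` decreases to `(k + √(k² - 4)) / 2`, and `Im f`
decreases in `β`. -/
theorem strictMonoOn_lensMap_topGraph (hk : 2 ≤ k) :
    StrictMonoOn (fun x => (lensMap k ⟨x, topGraph k x⟩).im) (Icc 0 (Real.pi / 2)) := by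
  have hanti : StrictAntiOn (topModulus k) (Icc 0 (Real.pi / 2)) := by
    intro x hx y hy hxy
    have h₁ := Real.cos_lt_cos_of_nonneg_of_le_pi_div_two hx.1 hy.2 hxy
    have h₂ : 0 ≤ Real.cos y := Real.cos_nonneg_of_mem_Icc ⟨by linarith [hy.1, Real.pi_pos], hy.2⟩
    have h₃ : √(k ^ 2 - 4 + 8 * Real.cos y ^ 2) < √(k ^ 2 - 4 + 8 * Real.cos x ^ 2) :=
      Real.sqrt_lt_sqrt (by nlinarith) (by nlinarith)
    rw [topModulus, topModulus]
    linarith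
  have hmaps : MapsTo (topModulus k) (Icc 0 (Real.pi / 2)) (Ici ((k + √(k ^ 2 - 4)) / 2)) := by
    intro x _
    have : √(k ^ 2 - 4) ≤ √(k ^ 2 - 4 + 8 * Real.cos x ^ 2) :=
      Real.sqrt_le_sqrt (by nlinarith [sq_nonneg (Real.cos x)])
    rw [mem_Ici, topModulus]
    linarith
  refine ((strictAntiOn_topImage hk).comp hanti hmaps).congr fun x hx => ?_
  exact (lensMap_topGraph_im hk (abs_le.2 ⟨by linarith [hx.1, Real.pi_pos], hx.2⟩)).symm

theorem lensMap_im_congr {z z' : ℂ} (hre : z'.re = -z.re) (him : z'.im = z.im) :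
    (lensMap k z').im = (lensMap k z).im := by
  rw [lensMap_im, lensMap_im, hre, him, Real.cos_neg]

theorem strictMonoOn_lensMap_capPath (hk : 2 ≤ k) :
    StrictMonoOn (fun s => (lensMap k (capPath (topGraph k) (Real.pi / 2) s)).im) (Ici 0) := by
  have hπ : 0 < Real.pi / 2 := by positivity
  have h₁ : StrictMonoOn (fun s => (lensMap k (capPath (topGraph k) (Real.pi / 2) s)).im)
      (Icc 0 (Real.pi / 2)) :=
    (strictMonoOn_lensMap_topGraph hk).congr fun s hs => by
      simp only
      rw [capPath_of_abs_le (abs_le.2 ⟨by linarith [hs.1], hs.2⟩)]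
  have h₂ : StrictMonoOn (fun s => (lensMap k (capPath (topGraph k) (Real.pi / 2) s)).im)
      (Ici (Real.pi / 2)) := by
    intro s hs t ht hst
    simp only
    rw [capPath_of_ge hπ.le hs, capPath_of_ge hπ.le ht, lensMap_im_of_re_eq (abs_of_pos hπ),
      lensMap_im_of_re_eq (abs_of_pos hπ)]
    simp only
    linarith
  have := h₁.union h₂ ⟨⟨hπ.le, le_rfl⟩, fun s hs => hs.2⟩ ⟨mem_Ici.2 le_rfl, fun s hs => hs⟩
  rwa [Icc_union_Ici_eq_Ici hπ.le] at this

theorem lensMap_capPath_neg (s : ℝ) :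
    (lensMap k (capPath (topGraph k) (Real.pi / 2) (-s))).im =
      (lensMap k (capPath (topGraph k) (Real.pi / 2) s)).im := by
  have hπ : 0 < Real.pi / 2 := by positivity
  have h : max (-(Real.pi / 2)) (min (-s) (Real.pi / 2)) =
      -max (-(Real.pi / 2)) (min s (Real.pi / 2)) := by grind
  refine lensMap_im_congr h ?_
  simp only [capPath, h, topGraph_neg, abs_neg]

theorem injOn_lensMap_capPath_Iic (hk : 2 ≤ k) :
    InjOn (fun s => (lensMap k (capPath (topGraph k) (Real.pi / 2) s)).im) (Iic 0) := by
  intro s hs t ht hst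
  exact neg_injective ((strictMonoOn_lensMap_capPath hk).injOn (mem_Ici.2 (neg_nonneg.2 hs))
    (mem_Ici.2 (neg_nonneg.2 ht)) (by simpa only [lensMap_capPath_neg] using hst))

end TopImage

/-! ### Winding numbers of the image curves of the components -/

/-- A path that meets the horizontal line through `w` at most once avoids one of the two horizontal
rays from `w`. -/
theorem exists_avoided_ray {g : ℝ → ℂ} {T : Set ℝ} {w : ℂ} (hg : InjOn (fun t => (g t).im) T)
    (hw : ∀ t ∈ T, g t ≠ w) :
    ∃ e : ℂ, (e = 1 ∨ e = -1) ∧ ∀ t ∈ T, e * (g t - w) ∈ slitPlane := by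
  by_cases h : ∃ t₀ ∈ T, (g t₀).im = w.im
  · obtain ⟨t₀, ht₀, him⟩ := h
    have hother : ∀ t ∈ T, t ≠ t₀ → (g t).im ≠ w.im := fun t ht hne h =>
      hne (hg ht ht₀ (h.trans him.symm))
    have hre : (g t₀).re ≠ w.re := fun h => hw t₀ ht₀ (Complex.ext h him)
    rcases hre.lt_or_gt with h | h
    · refine ⟨-1, Or.inr rfl, fun t ht => ?_⟩
      rw [mem_slitPlane_iff]
      by_cases htt : t = t₀
      · left; simpa [htt] using h
      · right; simpa [sub_eq_zero, eq_comm] using hother t ht htt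
    · refine ⟨1, Or.inl rfl, fun t ht => ?_⟩
      rw [mem_slitPlane_iff]
      by_cases htt : t = t₀
      · left; simpa [htt] using h
      · right; simpa [sub_eq_zero] using hother t ht htt
  · push Not at h
    refine ⟨1, Or.inl rfl, fun t ht => mem_slitPlane_iff.2 (Or.inr ?_)⟩
    simpa [sub_eq_zero] using h t ht

theorem mul_sub_mem_slitPlane_of_im_lt {e z w : ℂ} (he : e = 1 ∨ e = -1) (h : w.im < z.im) :
    e * (z - w) ∈ slitPlane := by
  rw [mem_slitPlane_iff]
  right
  rcases he with rfl | rfl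
  · simpa [sub_eq_zero] using h.ne'
  · simpa [sub_eq_zero] using h.ne

variable {k : ℝ}

/-- The right component of `D⁺`. -/
def rightPart (k : ℝ) : Set ℂ := lensRegion (sideGraph k) (sideHeight k) (Real.pi / 2)

/-- The upper component of `D⁺`, truncated at height `R`. -/
def upperPart (k R : ℝ) : Set ℂ := capRegion (topGraph k) (Real.pi / 2) R

theorem mem_rightPart_iff (hk : 2 ≤ k) {z : ℂ} : z ∈ rightPart k ↔
    z ∈ lensDplus k ∧ 0 < z.re ∧ Real.sinh z.im ^ 2 + 1 < k ^ 2 / 2 := mem_lensRegion_iff hk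

theorem mem_upperPart_iff (hk : 2 ≤ k) {R : ℝ} {z : ℂ} : z ∈ upperPart k R ↔
    z ∈ lensDplus k ∧ (0 < z.im ∧ k ^ 2 / 2 < Real.sinh z.im ^ 2 + 1) ∧ z.im < R := by
  rw [← and_assoc, ← topGraph_lt_im_iff hk, and_assoc]
  rfl

/-- Transfers the assumption on `w` to the boundary of a single piece. The artificial top edge runs
inside `D⁺` and needs the separate height estimate. -/
theorem mem_frontier_lensDplus (hk : 2 ≤ k) {V : Set ℂ} (hV : V ⊆ lensDplus k) {z : ℂ}
    (hz : z ∈ frontier V) (hz' : z ∉ lensDplus k) : z ∈ frontier (lensDplus k) := by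
  rw [(isOpen_lensDplus (by positivity)).frontier_eq]
  exact ⟨closure_mono hV hz.1, hz'⟩

theorem continuousOn_lensMap_comp (hk : 2 ≤ k) {γ : ℝ → ℂ} (hγ : Continuous γ)
    (h : ∀ t ∈ Icc (0 : ℝ) 1, 0 ≤ jacobianSign k (γ t)) :
    ContinuousOn (fun t => lensMap k (γ t)) (Icc 0 1) := fun t ht =>
  ((continuousAt_lensMap (sin_ne_zero_of_jacobianSign_nonneg (by positivity) (h t ht))).comp
    hγ.continuousAt).continuousWithinAt

theorem isPositiveJordanBoundary_rightPart (hk : 2 ≤ k) :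
    IsPositiveJordanBoundary (lensCurve (sideGraph k) (sideHeight k) (Real.pi / 2))
      (rightPart k) :=
  isPositiveJordanBoundary_lensCurve (sideHeight_pos hk) continuous_sideGraph
    (fun _ hy => sideGraph_lt hk (abs_lt.2 hy)) (sideGraph_sideHeight hk)
    (by rw [sideGraph_neg, sideGraph_sideHeight hk])

theorem jacobianSign_nonneg_of_mem_frontier (hk : 2 ≤ k) {V : Set ℂ} (hV : V ⊆ lensDplus k) {z : ℂ}
    (hz : z ∈ frontier V) : 0 ≤ jacobianSign k z :=
  jacobianSign_nonneg_of_mem_closure (by positivity) (closure_mono hV hz.1)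

theorem notMem_lensDplus_of_re {z : ℂ} (hz : |z.re| = Real.pi / 2) : z ∉ lensDplus k :=
  fun h => absurd h.1 (not_lt.2 hz.ge)

theorem notMem_lensDplus_of_jacobianSign (hk : 2 ≤ k) {z : ℂ} (hz : jacobianSign k z = 0) :
    z ∉ lensDplus k :=
  fun h => absurd ((mem_lensDplus_iff (by positivity)).1 h).2 (not_lt.2 hz.le)

theorem exists_winding_rightPart (hk : 2 ≤ k) {w : ℂ}
    (hw : w ∉ lensMap k '' frontier (lensDplus k)) :
    ∃ m : ℤ, |m| ≤ 1 ∧ ∃ γ, IsPositiveJordanBoundary γ (rightPart k) ∧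
      HasWindingNumber (fun t => lensMap k (γ t)) w m := by
  have hsub : rightPart k ⊆ lensDplus k := fun z hz => ((mem_rightPart_iff hk).1 hz).1
  have hγ := isPositiveJordanBoundary_rightPart hk
  have hb := sideHeight_pos hk
  have hXb := sideGraph_sideHeight hk
  have hπ : 0 < Real.pi / 2 := by positivity
  set γ := lensCurve (sideGraph k) (sideHeight k) (Real.pi / 2) with hγdef
  have hfr : ∀ t ∈ Icc (0 : ℝ) 1, γ t ∈ frontier (rightPart k) := fun t ht => by
    rw [← hγ.image_eq]; exact mem_image_of_mem _ ht
  have habs : ∀ t ∈ Icc (1 / 2 : ℝ) 1,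
      sideHeight k * (3 - 4 * t) ∈ Icc (-sideHeight k) (sideHeight k) := fun t ht =>
    ⟨by nlinarith [ht.2], by nlinarith [ht.1]⟩
  have hne : ∀ t ∈ Icc (0 : ℝ) 1, lensMap k (γ t) ≠ w := by
    intro t ht h
    refine hw ⟨γ t, mem_frontier_lensDplus hk hsub (hfr t ht) ?_, h⟩
    rcases le_total t (1 / 2) with ht' | ht'
    · rw [hγdef, lensCurve_of_le ht']
      exact notMem_lensDplus_of_re (abs_of_pos hπ)
    · rw [hγdef, lensCurve_of_ge hXb ht']
      exact notMem_lensDplus_of_jacobianSign hk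
        (jacobianSign_sideGraph hk (abs_le.2 (habs t ⟨ht', ht.2⟩)))
  have s₁ : Icc (0 : ℝ) (1 / 2) ⊆ Icc 0 1 := Icc_subset_Icc_right (by norm_num)
  have s₂ : Icc (1 / 2 : ℝ) 1 ⊆ Icc 0 1 := Icc_subset_Icc_left (by norm_num)
  obtain ⟨e₁, -, h₁⟩ := exists_avoided_ray (g := fun t => lensMap k (γ t))
    (T := Icc 0 (1 / 2)) (w := w) (fun s hs t ht hst => by
      simp only at hst
      rw [hγdef, lensCurve_of_le hs.2, lensCurve_of_le ht.2,
        lensMap_im_of_re_eq (abs_of_pos hπ), lensMap_im_of_re_eq (abs_of_pos hπ)] at hst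
      have := mul_left_cancel₀ hb.ne' hst
      linarith) (fun t ht => hne t (s₁ ht))
  obtain ⟨e₂, -, h₂⟩ := exists_avoided_ray (g := fun t => lensMap k (γ t))
    (T := Icc (1 / 2) 1) (w := w) (fun s hs t ht hst => by
      simp only at hst
      rw [hγdef, lensCurve_of_ge hXb hs.1, lensCurve_of_ge hXb ht.1] at hst
      have := mul_left_cancel₀ hb.ne'
        ((strictMonoOn_lensMap_sideGraph hk).injOn (habs s hs) (habs t ht) hst)
      linarith) (fun t ht => hne t (s₂ ht))
  obtain ⟨m, hm, hwn⟩ := exists_hasWindingNumber_of_two_arcs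
    (continuousOn_lensMap_comp hk (continuous_lensCurve continuous_sideGraph hXb)
      fun t ht => jacobianSign_nonneg_of_mem_frontier hk hsub (hfr t ht))
    (congrArg (lensMap k) hγ.closed) h₁ h₂
  exact ⟨m, hm, γ, hγ, hwn⟩

theorem exists_topGraph_lt : ∃ R₀ : ℝ, ∀ x ∈ Icc (-(Real.pi / 2)) (Real.pi / 2),
    topGraph k x < R₀ := by
  obtain ⟨M, hM⟩ := (isCompact_Icc.image (continuous_topGraph (k := k))).bddAbove
    (s := topGraph k '' Icc (-(Real.pi / 2)) (Real.pi / 2))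
  exact ⟨M + 1, fun x hx => (hM (mem_image_of_mem _ hx)).trans_lt (lt_add_one M)⟩

theorem capPath_topGraph_notMem (hk : 2 ≤ k) (s : ℝ) :
    capPath (topGraph k) (Real.pi / 2) s ∉ lensDplus k := by
  have hπ : 0 < Real.pi / 2 := by positivity
  rcases le_total |s| (Real.pi / 2) with h | h
  · rw [capPath_of_abs_le h]
    exact notMem_lensDplus_of_jacobianSign hk (jacobianSign_topGraph hk s)
  rcases le_total 0 s with h0 | h0
  · rw [abs_of_nonneg h0] at h
    rw [capPath_of_ge hπ.le h]
    exact notMem_lensDplus_of_re (abs_of_pos hπ)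
  · rw [abs_of_nonpos h0] at h
    rw [capPath_of_le_neg hπ.le (by linarith)]
    exact notMem_lensDplus_of_re (by rw [abs_neg]; exact abs_of_pos hπ)

theorem upperPart_subset (hk : 2 ≤ k) {R : ℝ} : upperPart k R ⊆ lensDplus k := fun _ hz =>
  ((mem_upperPart_iff hk).1 hz).1

theorem isPositiveJordanBoundary_upperPart {R : ℝ}
    (hR : ∀ x ∈ Icc (-(Real.pi / 2)) (Real.pi / 2), topGraph k x < R) :
    IsPositiveJordanBoundary (capCurve (topGraph k) (Real.pi / 2) R) (upperPart k R) :=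
  isPositiveJordanBoundary_capCurve (by positivity) continuous_topGraph hR (topGraph_neg _)

theorem capPath_mem_frontier_upperPart {R s : ℝ}
    (hR : ∀ x ∈ Icc (-(Real.pi / 2)) (Real.pi / 2), topGraph k x < R)
    (hs : |s| ≤ Real.pi / 2 + R - topGraph k (Real.pi / 2)) :
    capPath (topGraph k) (Real.pi / 2) s ∈ frontier (upperPart k R) := by
  have hπ : 0 < Real.pi / 2 := by positivity
  have hT : 0 < Real.pi / 2 + R - topGraph k (Real.pi / 2) := by
    linarith [hR (Real.pi / 2) ⟨by linarith, le_rfl⟩]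
  rw [abs_le] at hs
  have hq : -1 ≤ s / (Real.pi / 2 + R - topGraph k (Real.pi / 2)) ∧
      s / (Real.pi / 2 + R - topGraph k (Real.pi / 2)) ≤ 1 :=
    ⟨by rw [le_div_iff₀ hT]; linarith, by rw [div_le_iff₀ hT]; linarith⟩
  rw [← (isPositiveJordanBoundary_upperPart hR).image_eq]
  refine ⟨(s / (Real.pi / 2 + R - topGraph k (Real.pi / 2)) + 1) / 4,
    ⟨by linarith, by linarith⟩, ?_⟩
  rw [capCurve_of_le (by linarith)]
  congr 1
  rw [mul_div_cancel₀ _ four_ne_zero, add_sub_cancel_right, div_mul_cancel₀ _ hT.ne']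

/-- Facts about frontiers of truncations thereby hold on the whole infinite path, which does not
involve `R`. -/
theorem exists_capPath_mem_frontier (hk : 2 ≤ k) (s : ℝ) : ∃ R,
    capPath (topGraph k) (Real.pi / 2) s ∈ frontier (upperPart k R) := by
  obtain ⟨R₀, hR₀⟩ := exists_topGraph_lt (k := k)
  have h0 := topGraph_pos hk (Real.pi / 2)
  refine ⟨max R₀ (|s| + topGraph k (Real.pi / 2)), capPath_mem_frontier_upperPart
    (fun x hx => (hR₀ x hx).trans_le (le_max_left _ _)) ?_⟩
  linarith [le_max_right R₀ (|s| + topGraph k (Real.pi / 2)), Real.pi_pos]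

/-- The avoided rays are chosen for the two infinite halves of `capPath`, before `R`; so one `m`
serves all large `R`. -/
theorem exists_winding_upperPart (hk : 2 ≤ k) {w : ℂ}
    (hw : w ∉ lensMap k '' frontier (lensDplus k)) :
    ∃ m : ℤ, |m| ≤ 1 ∧ (w.im ≤ 0 → m = 0) ∧ ∀ᶠ R in Filter.atTop,
      ∃ γ, IsPositiveJordanBoundary γ (upperPart k R) ∧
        HasWindingNumber (fun t => lensMap k (γ t)) w m := by
  have hπ : 0 < Real.pi / 2 := by positivity
  have hk0 : 0 < k := by linarith
  set P : ℝ → ℂ := capPath (topGraph k) (Real.pi / 2) with hP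
  have hPJ : ∀ s, 0 ≤ jacobianSign k (P s) := fun s => by
    obtain ⟨R, hR⟩ := exists_capPath_mem_frontier hk s
    exact jacobianSign_nonneg_of_mem_frontier hk (upperPart_subset hk) hR
  have hPw : ∀ s, lensMap k (P s) ≠ w := fun s h => by
    obtain ⟨R, hR⟩ := exists_capPath_mem_frontier hk s
    exact hw ⟨P s, mem_frontier_lensDplus hk (upperPart_subset hk) hR
      (capPath_topGraph_notMem hk s), h⟩
  have hPim : ∀ s, 0 < (lensMap k (P s)).im := fun s => by
    have hre := capPath_re_mem (Y := topGraph k) hπ s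
    refine lensMap_im_pos hk0 (hPJ s) (Real.cos_nonneg_of_mem_Icc hre) ?_
    exact add_pos_of_pos_of_nonneg (topGraph_pos hk _) (le_max_right _ _)
  obtain ⟨e₁, e₂, he₁, he₂, h₁, h₂, he⟩ : ∃ e₁ e₂ : ℂ, (e₁ = 1 ∨ e₁ = -1) ∧ (e₂ = 1 ∨ e₂ = -1) ∧
      (∀ s ∈ Iic (0 : ℝ), e₁ * (lensMap k (P s) - w) ∈ slitPlane) ∧
      (∀ s ∈ Ici (0 : ℝ), e₂ * (lensMap k (P s) - w) ∈ slitPlane) ∧ (w.im ≤ 0 → e₁ = e₂) := by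
    by_cases hw0 : w.im ≤ 0
    -- The path stays above `w`, so one ray serves both halves, which makes `m` vanish.
    · exact ⟨1, 1, Or.inl rfl, Or.inl rfl,
        fun s _ => mul_sub_mem_slitPlane_of_im_lt (Or.inl rfl) (hw0.trans_lt (hPim s)),
        fun s _ => mul_sub_mem_slitPlane_of_im_lt (Or.inl rfl) (hw0.trans_lt (hPim s)),
        fun _ => rfl⟩
    · obtain ⟨e₁, he₁, h₁⟩ := exists_avoided_ray (g := fun s => lensMap k (P s))
        (injOn_lensMap_capPath_Iic hk) (fun s _ => hPw s)
      obtain ⟨e₂, he₂, h₂⟩ := exists_avoided_ray (g := fun s => lensMap k (P s))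
        (strictMonoOn_lensMap_capPath hk).injOn (fun s _ => hPw s)
      exact ⟨e₁, e₂, he₁, he₂, h₁, h₂, fun h => absurd h hw0⟩
  obtain ⟨m, hm, hm0, hmw⟩ := exists_hasWindingNumber_of_base (hPw 0) he₁ he₂
    (h₁ 0 self_mem_Iic) (h₂ 0 self_mem_Ici)
  refine ⟨m, hm, fun h => hm0 (he h), ?_⟩
  obtain ⟨R₀, hR₀⟩ := exists_topGraph_lt (k := k)
  -- On the top edge `Im f ≥ R - 1`, so `R > Im w + 1` puts its image above `w`.
  filter_upwards [Filter.eventually_ge_atTop R₀, Filter.eventually_gt_atTop (w.im + 1)] with R hR hRw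
  have hYR : ∀ x ∈ Icc (-(Real.pi / 2)) (Real.pi / 2), topGraph k x < R := fun x hx =>
    (hR₀ x hx).trans_le hR
  have hYp : topGraph k (Real.pi / 2) < R := hYR _ ⟨by linarith, le_rfl⟩
  have hT : 0 < Real.pi / 2 + R - topGraph k (Real.pi / 2) := by linarith
  have hγ := isPositiveJordanBoundary_upperPart hYR
  set γ := capCurve (topGraph k) (Real.pi / 2) R with hγdef
  have hJ : ∀ t ∈ Icc (0 : ℝ) 1, 0 ≤ jacobianSign k (γ t) := fun t ht =>
    jacobianSign_nonneg_of_mem_frontier hk (upperPart_subset hk)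
      (by rw [← hγ.image_eq]; exact mem_image_of_mem _ ht)
  have hedge : ∀ t ∈ Icc (1 / 2 : ℝ) 1, w.im < (lensMap k (γ t)).im := fun t ht => by
    have hJt := hJ t ⟨by linarith [ht.1], ht.2⟩
    rw [hγdef, capCurve_of_ge hπ hYp ht.1] at hJt ⊢
    have := sub_one_le_lensMap_im hk0 hJt
      (Real.cos_nonneg_of_mem_Icc ⟨by nlinarith [ht.2], by nlinarith [ht.1]⟩)
      ((topGraph_pos hk _).trans hYp).le
    simp only at this
    linarith
  refine ⟨γ, hγ, hmw _ (continuousOn_lensMap_comp hk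
    (continuous_capCurve hπ hYp continuous_topGraph) hJ) (congrArg (lensMap k) hγ.closed) ?_ ?_ ?_ ?_ ?_⟩
  -- In `capCurve` the parameter `1 / 4` is the point `s = 0` of `capPath`, and `3 / 4` the midpoint
  -- of the top edge.
  · intro t ht
    rw [hγdef, capCurve_of_le (by linarith [ht.2])]
    exact h₁ _ (mul_nonpos_of_nonpos_of_nonneg (by linarith [ht.2]) hT.le)
  · intro t ht
    rcases le_total t (1 / 2) with ht' | ht'
    · rw [hγdef, capCurve_of_le ht']
      exact h₂ _ (mul_nonneg (by linarith [ht.1]) hT.le)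
    · exact mul_sub_mem_slitPlane_of_im_lt he₂ (hedge t ⟨ht', by linarith [ht.2]⟩)
  · intro t ht
    exact mul_sub_mem_slitPlane_of_im_lt he₁ (hedge t ⟨by linarith [ht.1], ht.2⟩)
  · rw [hγdef, capCurve_of_le (by norm_num)]
    norm_num [hP]
  · exact hedge _ (by norm_num)

/-! ### Decomposition of `D⁺` into four components, and the conclusion -/

/-- The four sets `A`, `-A`, `B`, `-B`. -/
def fourParts (A B : Set ℂ) : Fin 4 → Set ℂ := ![A, -A, B, -B]

theorem forall_fourParts {A B : Set ℂ} {p : Set ℂ → Prop} (hA : p A) (hA' : p (-A)) (hB : p B)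
    (hB' : p (-B)) (i : Fin 4) : p (fourParts A B i) := by
  fin_cases i
  exacts [hA, hA', hB, hB']

theorem mem_iUnion_fourParts {A B : Set ℂ} {z : ℂ} :
    z ∈ ⋃ i, fourParts A B i ↔ z ∈ A ∨ -z ∈ A ∨ z ∈ B ∨ -z ∈ B := by
  simp [fourParts, Fin.exists_fin_succ]

theorem IsPreconnected.neg_complex {A : Set ℂ} (hA : IsPreconnected A) : IsPreconnected (-A) := by
  rw [← image_neg_eq_neg]
  exact hA.image _ continuous_neg.continuousOn

theorem disjoint_fourParts (k : ℝ) {A B : Set ℂ}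
    (hA : ∀ z ∈ A, 0 < z.re ∧ Real.sinh z.im ^ 2 + 1 < k ^ 2 / 2)
    (hB : ∀ z ∈ B, 0 < z.im ∧ k ^ 2 / 2 < Real.sinh z.im ^ 2 + 1) :
    Pairwise (Function.onFun Disjoint (fourParts A B)) := by
  have hA' : ∀ z ∈ -A, z.re < 0 ∧ Real.sinh z.im ^ 2 + 1 < k ^ 2 / 2 := fun z hz => by
    simpa using hA _ hz
  have hB' : ∀ z ∈ -B, z.im < 0 ∧ k ^ 2 / 2 < Real.sinh z.im ^ 2 + 1 := fun z hz => by
    simpa using hB _ hz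
  have d₁ : Disjoint A (-A) := disjoint_left.2 fun z h h' => by linarith [(hA z h).1, (hA' z h').1]
  have d₂ : Disjoint A B := disjoint_left.2 fun z h h' => by linarith [(hA z h).2, (hB z h').2]
  have d₃ : Disjoint A (-B) := disjoint_left.2 fun z h h' => by linarith [(hA z h).2, (hB' z h').2]
  have d₄ : Disjoint (-A) B := disjoint_left.2 fun z h h' => by linarith [(hA' z h).2, (hB z h').2]
  have d₅ : Disjoint (-A) (-B) :=
    disjoint_left.2 fun z h h' => by linarith [(hA' z h).2, (hB' z h').2]
  have d₆ : Disjoint B (-B) := disjoint_left.2 fun z h h' => by linarith [(hB z h).1, (hB' z h').1]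
  intro i j hij
  fin_cases i <;> fin_cases j
  exacts [absurd rfl hij, d₁, d₂, d₃, d₁.symm, absurd rfl hij, d₄, d₅, d₂.symm, d₄.symm,
    absurd rfl hij, d₆, d₃.symm, d₅.symm, d₆.symm, absurd rfl hij]

/-- The Jacobian determinant is negative on the lines that separate the components of `D⁺`. -/
theorem lensDplus_cases (hk : 2 ≤ k) {z : ℂ} (hz : z ∈ lensDplus k) :
    (0 < z.re ∧ Real.sinh z.im ^ 2 + 1 < k ^ 2 / 2) ∨
    (z.re < 0 ∧ Real.sinh z.im ^ 2 + 1 < k ^ 2 / 2) ∨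
    (0 < z.im ∧ k ^ 2 / 2 < Real.sinh z.im ^ 2 + 1) ∨
    (z.im < 0 ∧ k ^ 2 / 2 < Real.sinh z.im ^ 2 + 1) := by
  obtain ⟨h₁, h₂⟩ := (mem_lensDplus_iff (by positivity)).1 hz
  have hu : 0 < Real.cos z.re ^ 2 := by
    have := Real.cos_pos_of_mem_Ioo (abs_lt.1 h₁)
    positivity
  have hu1 := cos_sq_le_one z.re
  rw [jacobianSign] at h₂
  have hs := sq_nonneg (Real.sinh z.im)
  rcases lt_trichotomy (Real.sinh z.im ^ 2 + 1) (k ^ 2 / 2) with h | h | h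
  · rcases lt_trichotomy z.re 0 with hx | hx | hx
    · exact Or.inr (Or.inl ⟨hx, h⟩)
    · rw [hx, Real.cos_zero] at h₂
      nlinarith
    · exact Or.inl ⟨hx, h⟩
  -- On this line the expression is `-k² (k² - 4) / 4 - u (2 k² - u)` with `u = cos² x`, which is
  -- negative inside the strip.
  · have hs' : Real.sinh z.im ^ 2 = k ^ 2 / 2 - 1 := by linarith
    rw [hs'] at h₂
    nlinarith [mul_pos hu (show 0 < 2 * k ^ 2 - Real.cos z.re ^ 2 by nlinarith),
      mul_nonneg (sq_nonneg k) (show 0 ≤ k ^ 2 - 4 by nlinarith)]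
  · rcases lt_trichotomy z.im 0 with hy | hy | hy
    · exact Or.inr (Or.inr (Or.inr ⟨hy, h⟩))
    · rw [hy, Real.sinh_zero] at h
      nlinarith
    · exact Or.inr (Or.inr (Or.inl ⟨hy, h⟩))

theorem isPreconnected_upper : IsPreconnected (⋃ R, upperPart k R) := by
  have : (⋃ R, upperPart k R) =
      (fun q : ℝ × ℝ => (⟨q.1, topGraph k q.1 + q.2⟩ : ℂ)) ''
        (Ioo (-(Real.pi / 2)) (Real.pi / 2) ×ˢ Ioi 0) := by
    ext z
    constructor
    · intro hz
      obtain ⟨R, h₁, h₂, -⟩ := mem_iUnion.1 hz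
      refine ⟨(z.re, z.im - topGraph k z.re), ⟨abs_lt.1 h₁, sub_pos.2 h₂⟩, ?_⟩
      exact Complex.ext rfl (add_sub_cancel _ _)
    · rintro ⟨⟨x, y⟩, ⟨hx, hy⟩, rfl⟩
      exact mem_iUnion.2 ⟨topGraph k x + y + 1, abs_lt.2 hx, lt_add_of_pos_right _ hy,
        lt_add_one _⟩
  rw [this]
  refine (isPreconnected_Ioo.prod isPreconnected_Ioi).image _ (Continuous.continuousOn ?_)
  have := continuous_topGraph (k := k)
  exact continuous_complex_mk (by fun_prop) (by fun_prop)

theorem isOpen_rightPart : IsOpen (rightPart k) := isOpen_lensRegion continuous_sideGraph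

theorem isPreconnected_rightPart (hk : 2 ≤ k) : IsPreconnected (rightPart k) :=
  isPreconnected_lensRegion continuous_sideGraph fun _ hy => sideGraph_lt hk (abs_lt.2 hy)

theorem nonempty_rightPart (hk : 2 ≤ k) : (rightPart k).Nonempty := by
  have hb := sideHeight_pos hk
  have h := sideGraph_lt hk (y := 0) (by simpa using hb)
  exact ⟨⟨(sideGraph k 0 + Real.pi / 2) / 2, 0⟩, by simpa using hb, by simp only; linarith,
    by simp only; linarith⟩

theorem nonempty_upperPart {R : ℝ} (hR : topGraph k 0 < R) : (upperPart k R).Nonempty :=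
  ⟨⟨0, (topGraph k 0 + R) / 2⟩, by simpa using Real.pi_pos, by simp only; linarith,
    by simp only; linarith⟩

theorem lensDplus_eq_iUnion (hk : 2 ≤ k) :
    lensDplus k = ⋃ i, fourParts (rightPart k) (⋃ R, upperPart k R) i := by
  have hk0 : k ≠ 0 := by positivity
  ext z
  rw [mem_iUnion_fourParts]
  simp only [mem_rightPart_iff hk, mem_iUnion, mem_upperPart_iff hk,
    neg_mem_lensDplus_iff hk0, neg_re, neg_im, Real.sinh_neg, neg_sq, Left.neg_pos_iff]
  constructor
  · intro hz
    rcases lensDplus_cases hk hz with h | h | h | h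
    · exact Or.inl ⟨hz, h⟩
    · exact Or.inr (Or.inl ⟨hz, h⟩)
    · exact Or.inr (Or.inr (Or.inl ⟨z.im + 1, hz, h, lt_add_one _⟩))
    · exact Or.inr (Or.inr (Or.inr ⟨-z.im + 1, hz, h, lt_add_one _⟩))
  · rintro (h | h | ⟨_, h⟩ | ⟨_, h⟩) <;> exact h.1

theorem lensDplusTrunc_eq_iUnion (hk : 2 ≤ k) {R : ℝ} (hR : sideHeight k < R) :
    lensDplusTrunc k R = ⋃ i, fourParts (rightPart k) (upperPart k R) i := by
  have hk0 : k ≠ 0 := by positivity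
  have hside : ∀ {z : ℂ}, z ∈ rightPart k → |z.im| < R := fun hz => hz.1.trans hR
  ext z
  rw [mem_iUnion_fourParts, mem_upperPart_iff hk, mem_upperPart_iff hk]
  constructor
  · rintro ⟨hz, hzR⟩
    have hzR := abs_lt.1 (show |z.im| < R from hzR)
    rw [mem_rightPart_iff hk, mem_rightPart_iff hk]
    simp only [neg_mem_lensDplus_iff hk0, neg_re, neg_im, Real.sinh_neg, neg_sq, Left.neg_pos_iff]
    rcases lensDplus_cases hk hz with h | h | h | h
    · exact Or.inl ⟨hz, h⟩
    · exact Or.inr (Or.inl ⟨hz, h⟩)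
    · exact Or.inr (Or.inr (Or.inl ⟨hz, h, hzR.2⟩))
    · exact Or.inr (Or.inr (Or.inr ⟨hz, h, by linarith⟩))
  · rintro (h | h | h | h)
    · exact ⟨((mem_rightPart_iff hk).1 h).1, hside h⟩
    · exact ⟨(neg_mem_lensDplus_iff hk0).1 ((mem_rightPart_iff hk).1 h).1, by
        simpa using hside h⟩
    · exact ⟨h.1, show |z.im| < R by rw [abs_of_pos h.2.1.1]; exact h.2.2⟩
    · refine ⟨(neg_mem_lensDplus_iff hk0).1 h.1, show |z.im| < R from ?_⟩
      rw [← abs_neg, ← neg_im, abs_of_pos h.2.1.1]; exact h.2.2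

theorem encard_componentsOf_lensDplus_le (hk : 2 ≤ k) :
    (componentsOf (lensDplus k)).encard ≤ 4 := by
  have hB : IsOpen (⋃ R, upperPart k R) :=
    isOpen_iUnion fun _ => isOpen_capRegion continuous_topGraph
  have hBne : (⋃ R, upperPart k R).Nonempty := by
    obtain ⟨z, hz⟩ := nonempty_upperPart (lt_add_one (topGraph k 0))
    exact ⟨z, mem_iUnion.2 ⟨_, hz⟩⟩
  rw [lensDplus_eq_iUnion hk, componentsOf_iUnion
    (forall_fourParts isOpen_rightPart isOpen_rightPart.neg hB hB.neg)
    (forall_fourParts (isPreconnected_rightPart hk) (isPreconnected_rightPart hk).neg_complex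
      isPreconnected_upper isPreconnected_upper.neg_complex)
    (forall_fourParts (nonempty_rightPart hk) (nonempty_rightPart hk).neg hBne hBne.neg)
    (disjoint_fourParts k (fun z hz => ((mem_rightPart_iff hk).1 hz).2) fun z hz => by
      obtain ⟨R, hR⟩ := mem_iUnion.1 hz
      exact ((mem_upperPart_iff hk).1 hR).2.1), ← image_univ]
  refine (encard_image_le _ _).trans ?_
  rw [encard_univ]
  simp

theorem exists_winding_neg {V : Set ℂ} {w : ℂ} {m : ℤ}
    (h : ∃ γ, IsPositiveJordanBoundary γ V ∧ HasWindingNumber (fun t => lensMap k (γ t)) (-w) m) :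
    ∃ γ, IsPositiveJordanBoundary γ (-V) ∧
      HasWindingNumber (fun t => lensMap k (γ t)) w m := by
  obtain ⟨γ, hγ, hw⟩ := h
  refine ⟨fun t => -γ t, hγ.neg, ?_⟩
  simpa only [lensMap_neg, neg_neg] using hw.neg

theorem neg_notMem_lensMap_frontier (hk : 2 ≤ k) {w : ℂ}
    (hw : w ∉ lensMap k '' frontier (lensDplus k)) :
    -w ∉ lensMap k '' frontier (lensDplus k) := by
  rintro ⟨z, hz, hzw⟩
  refine hw ⟨-z, ?_, by rw [lensMap_neg, hzw, neg_neg]⟩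
  have h : (Homeomorph.neg ℂ) ⁻¹' lensDplus k = lensDplus k :=
    Set.ext fun z => neg_mem_lensDplus_iff (by positivity)
  rw [← h, ← (Homeomorph.neg ℂ).preimage_frontier]
  simpa using hz

theorem proposition2 (k : ℝ) (hk : 2 ≤ k) :
    (componentsOf (lensDplus k)).encard ≤ 4 ∧
    ∀ w : ℂ, w ∉ lensMap k '' frontier (lensDplus k) →
      ∃ m : ℤ, HasDplusIndex k w m ∧ |m| ≤ 3 := by
  refine ⟨encard_componentsOf_lensDplus_le hk, fun w hw => ?_⟩
  have hw' := neg_notMem_lensMap_frontier hk hw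
  obtain ⟨m₁, hm₁, h₁⟩ := exists_winding_rightPart hk hw
  obtain ⟨m₂, hm₂, h₂⟩ := exists_winding_rightPart hk hw'
  obtain ⟨m₃, hm₃, hz₃, h₃⟩ := exists_winding_upperPart hk hw
  obtain ⟨m₄, hm₄, hz₄, h₄⟩ := exists_winding_upperPart hk hw'
  obtain ⟨R₀, hR₀⟩ := exists_topGraph_lt (k := k)
  refine ⟨∑ i, ![m₁, m₂, m₃, m₄] i, ?_, ?_⟩
  · filter_upwards [h₃, h₄, Filter.eventually_gt_atTop (sideHeight k),
      Filter.eventually_ge_atTop R₀] with R h₃ h₄ hR hR'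
    have hB : IsOpen (upperPart k R) := isOpen_capRegion continuous_topGraph
    have hYR : ∀ x ∈ Icc (-(Real.pi / 2)) (Real.pi / 2), topGraph k x < R := fun x hx =>
      (hR₀ x hx).trans_le hR'
    have hBp : IsPreconnected (upperPart k R) :=
      isPreconnected_capRegion continuous_topGraph fun x hx => hYR x (Ioo_subset_Icc_self hx)
    have hBne := nonempty_upperPart (hYR 0 ⟨by linarith [Real.pi_pos], by positivity⟩)
    have key : HasBoundaryIndex (lensMap k) (lensDplusTrunc k R) w (∑ i, ![m₁, m₂, m₃, m₄] i) := by
      rw [lensDplusTrunc_eq_iUnion hk hR]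
      refine hasBoundaryIndex_iUnion
        (forall_fourParts isOpen_rightPart isOpen_rightPart.neg hB hB.neg)
        (forall_fourParts (isPreconnected_rightPart hk) (isPreconnected_rightPart hk).neg_complex
          hBp hBp.neg_complex)
        (forall_fourParts (nonempty_rightPart hk) (nonempty_rightPart hk).neg hBne hBne.neg)
        (disjoint_fourParts k (fun z hz => ((mem_rightPart_iff hk).1 hz).2)
          fun z hz => ((mem_upperPart_iff hk).1 hz).2.1) fun i => ?_
      fin_cases i
      exacts [h₁, exists_winding_neg h₂, h₃, exists_winding_neg h₄]
    exact ⟨key, fun m' hm' => key.unique hm'⟩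
  -- Either `w` or `-w` has nonpositive imaginary part, so the upper or the lower component
  -- contributes nothing.
  · have : m₃ = 0 ∨ m₄ = 0 := (le_total w.im 0).imp hz₃ fun h => hz₄ (by simpa using h)
    simp only [Fin.sum_univ_four, Matrix.cons_val]
    rw [abs_le] at *
    omega

end
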